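/- Let $\mathcal{A}$ be a unital algebra over a commutative unital ring $\mathcal{R}$, let $e\in\mathcal{A}$ be a nontrivial idempotent ($e\neq 0,1$), let $f=1-e$, and let $n\ge 2$. Write $[x,y]=xy-yx$, let $\mathcal{Z}(\cdot)$ denote the centre, and put $p_1(x_1)=x_1$, $p_k(x_1,\dots,x_k)=[p_{k-1}(x_1,\dots,x_{k-1}),x_k]$ for $k\ge 2$; the values of $p_n$ are called $(n-1)$-th commutators. An $\mathcal{R}$-linear map $\varphi:\mathcal{A}\to\mathcal{A}$ is a *Lie $n$-derivation* if $$\varphi(p_n(x_1,\dots,x_n))=\sum_{i=1}^n p_n(x_1,\dots,x_{i-1},\varphi(x_i),x_{i+1},\dots,x_n)\quad\text{for all }x_1,\dots,x_n\in\mathcal{A},$$ and it is *standard* if $\varphi=h+\tau$ with $h$ a derivation and $\tau:\mathcal{A}\to\mathcal{Z}(\mathcal{A})$ a linear map vanishing on all $(n-1)$-th commutators. A linear map $\delta$ is a *Jordan derivation* if $\delta(x\circ y)=\delta(x)\circ y+x\circ\delta(y)$ for all $x,y$, where $x\circ y=xy+yx$; it is an *antiderivation* if $\delta(xy)=\delta(y)x+y\delta(x)$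 for all $x,y$; a Jordan derivation is *singular* if $\delta(e\mathcal{A}e)=\delta(f\mathcal{A}f)=\{0\}$, $\delta(e\mathcal{A}f)\subseteq f\mathcal{A}e$ and $\delta(f\mathcal{A}e)\subseteq e\mathcal{A}f$. For an algebra $\mathcal{B}$, let $\mathcal{S}(\mathcal{B})$ be the subalgebra generated by all idempotents and all commutators of $\mathcal{B}$; a *central ideal* of $\mathcal{B}$ is a two-sided ideal contained in $\mathcal{Z}(\mathcal{B})$; and $\mathcal{B}$ *has no nonzero central inner derivation* if, for each $x\in\mathcal{B}$, $[x,\mathcal{B}]\subseteq\mathcal{Z}(\mathcal{B})$ implies $x\in\mathcal{Z}(\mathcal{B})$. Assume that $2x=0$ implies $x=0$ and $(n-1)x=0$ implies $x=0$ for each $x\in\mathcal{A}$, and that for each $x\in\mathcal{A}$: - $exe\cdot e\mathcal{A}f=\{0\}=f\mathcal{A}e\cdot exe$ implies $exe=0$, and - $e\mathcal{A}f\cdot fxf=\{0\}=fxf\cdot f\mathcal{A}e$ implies $fxf=0$. Let $\varphi$ be a Lie $n$-derivation on $\mathcal{A}$. Suppose that at least one of the following holds: - (i-1) $f\varphi(e\mathcal{A}e)f\subseteq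 f\mathcal{Z}(\mathcal{A})f$ and $e\varphi(f\mathcal{A}f)e\subseteq e\mathcal{Z}(\mathcal{A})e$; - (i-2) $e\mathcal{A}e=\mathcal{S}(e\mathcal{A}e)$ and $f\mathcal{A}f=\mathcal{S}(f\mathcal{A}f)$; - (i-3) $e\mathcal{A}e=\mathcal{S}(e\mathcal{A}e)$ and $\mathcal{Z}(e\mathcal{A}e)=e\mathcal{Z}(\mathcal{A})e$; - (i-4) $f\mathcal{A}f=\mathcal{S}(f\mathcal{A}f)$ and $\mathcal{Z}(f\mathcal{A}f)=f\mathcal{Z}(\mathcal{A})f$; - (i-5) $\mathcal{Z}(e\mathcal{A}e)=e\mathcal{Z}(\mathcal{A})e$, $\mathcal{Z}(f\mathcal{A}f)=f\mathcal{Z}(\mathcal{A})f$ and, if $n\ge 3$, at least one of $e\mathcal{A}e$, $f\mathcal{A}f$ has no nonzero central inner derivation; and that at least one of the following holds: - (ii-1) $e\varphi(tm)e+f\varphi(mt)f\in\mathcal{Z}(\mathcal{A})$ for all $m\in e\mathcal{A}f$, $t\in f\mathcal{A}e$; - (ii-2) $e\mathcal{A}e$ or $f\mathcal{A}f$ has no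 nonzero central ideal; - (ii-3) $\mathcal{Z}(\mathcal{A})=\{a+b : a\in e\mathcal{Z}(\mathcal{A})e,\ b\in f\mathcal{Z}(\mathcal{A})f,\ am_0=m_0b\}$ for some $m_0\in e\mathcal{A}f$; - (ii-4) $\mathcal{Z}(\mathcal{A})=\{a+b : a\in e\mathcal{Z}(\mathcal{A})e,\ b\in f\mathcal{Z}(\mathcal{A})f,\ t_0a=bt_0\}$ for some $t_0\in f\mathcal{A}e$; - (ii-5) $e\mathcal{A}f\cdot f\mathcal{A}e=f\mathcal{A}e\cdot e\mathcal{A}f=\{0\}$. Then $\varphi=d+\delta+\gamma$, where $d$ is a derivation on $\mathcal{A}$, $\delta$ is a singular Jordan derivation on $\mathcal{A}$, and $\gamma:\mathcal{A}\to\mathcal{Z}(\mathcal{A})$ is a linear map vanishing on all $(n-1)$-th commutators of $\mathcal{A}$; moreover $\delta$ is also an antiderivation when (ii-2) or (ii-5) holds. If, in addition, $n$ is even or $f\varphi(e\mathcal{A}f)e=e\varphi(f\mathcal{A}e)f=\{0\}$, then $\varphi$ is standard. -/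

import Mathlib

/-- The polynomials `p_n`: `p_1(x_1) = x_1` and
`p_n(x_1, …, x_n) = [p_{n-1}(x_1, …, x_{n-1}), x_n]` for `n ≥ 2`, where `[x, y] = x y - y x`.
The values of `p_n` (`n ≥ 2`) are the `(n-1)`-th commutators. The value for `n = 0` is irrelevant. -/
def lieP {A : Type*} [Ring A] : (n : ℕ) → (Fin n → A) → A
  | 0, _ => 0
  | 1, x => x 0
  | n + 2, x => ⁅lieP (n + 1) (fun i => x i.castSucc), x (Fin.last (n + 1))⁆

/-- `A` is `k`-torsion free: `k x = 0` implies `x = 0`. -/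
def IsTorsionFreeBy (A : Type*) [Ring A] (k : ℕ) : Prop :=
  ∀ x : A, k • x = 0 → x = 0

section Maps

variable {R A : Type*} [CommRing R] [Ring A] [Algebra R A]

/-- A linear map `δ` with `δ(xy) = δ(x)y + xδ(y)`. -/
def IsDerivationMap (δ : A →ₗ[R] A) : Prop :=
  ∀ x y : A, δ (x * y) = δ x * y + x * δ y

/-- A linear map `δ` with `δ(xy) = δ(y)x + yδ(x)`. -/
def IsAntiderivationMap (δ : A →ₗ[R] A) : Prop :=
  ∀ x y : A, δ (x * y) = δ y * x + y * δ x

/-- A linear map `δ` with `δ(x ∘ y) = δ(x) ∘ y + x ∘ δ(y)`, where `x ∘ y = xy + yx`. -/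
def IsJordanDerivationMap (δ : A →ₗ[R] A) : Prop :=
  ∀ x y : A, δ (x * y + y * x) = (δ x * y + y * δ x) + (x * δ y + δ y * x)

/-- A linear map `δ` with
`δ(p_n(x_1, …, x_n)) = ∑_i p_n(x_1, …, x_{i-1}, δ(x_i), x_{i+1}, …, x_n)`. -/
def IsLieNDerivation (n : ℕ) (δ : A →ₗ[R] A) : Prop :=
  ∀ x : Fin n → A, δ (lieP n x) = ∑ i : Fin n, lieP n (Function.update x i (δ (x i)))

/-- A linear map into the centre of `A` vanishing on all `(n-1)`-th commutators. -/
def IsCentralVanishing (n : ℕ) (γ : A →ₗ[R] A) : Prop :=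
  (∀ x : A, γ x ∈ Set.center A) ∧ ∀ x : Fin n → A, γ (lieP n x) = 0

/-- `φ = h + τ` with `h` a derivation and `τ` a linear map into the centre vanishing on all
`(n-1)`-th commutators. -/
def IsStandard (n : ℕ) (φ : A →ₗ[R] A) : Prop :=
  ∃ h τ : A →ₗ[R] A, IsDerivationMap h ∧ IsCentralVanishing n τ ∧ φ = h + τ

end Maps

section Peirce

variable {A : Type*} [Ring A]

/-- The Peirce component `gAh = {g x h : x ∈ A}`. -/
def peirceComp (g h : A) : Set A := Set.range fun x : A => g * x * h

/-- The set `gZ(A)g`. -/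
def cornerOfCenter (g : A) : Set A := (fun z : A => g * z * g) '' Set.center A

/-- For each `x`: `exe · eAf = 0 = fAe · exe` implies `exe = 0`, and
`eAf · fxf = 0 = fxf · fAe` implies `fxf = 0`. -/
def PeirceFaithful (e f : A) : Prop :=
  ∀ x : A,
    ((∀ m ∈ peirceComp e f, (e * x * e) * m = 0) → (∀ t ∈ peirceComp f e, t * (e * x * e) = 0) →
      e * x * e = 0) ∧
    ((∀ m ∈ peirceComp e f, m * (f * x * f) = 0) → (∀ t ∈ peirceComp f e, (f * x * f) * t = 0) →
      f * x * f = 0)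

/-- `eAf · fAe = fAe · eAf = 0`. -/
def PeirceOrthogonal (e f : A) : Prop :=
  ∀ m ∈ peirceComp e f, ∀ t ∈ peirceComp f e, m * t = 0 ∧ t * m = 0

end Peirce

/-- The algebra `gAg`; for idempotent `g` it is a ring with unit `g`. -/
def corner (R : Type*) {A : Type*} [CommRing R] [Ring A] [Algebra R A] (g : A) :
    NonUnitalSubalgebra R A where
  carrier := peirceComp g g
  add_mem' := by
    rintro _ _ ⟨x, rfl⟩ ⟨y, rfl⟩
    exact ⟨x + y, by simp [mul_add, add_mul]⟩
  zero_mem' := ⟨0, by simp⟩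
  mul_mem' := by
    rintro _ _ ⟨x, rfl⟩ ⟨y, rfl⟩
    exact ⟨x * g * g * y, by simp [mul_assoc]⟩
  smul_mem' := by
    rintro c _ ⟨x, rfl⟩
    exact ⟨c • x, by simp⟩

section Intrinsic

/-- `S(B)`: the subalgebra of `B` generated by all idempotents and all commutators of `B`. -/
def idemCommSubalgebra (R B : Type*) [CommRing R] [NonUnitalRing B] [Module R B]
    [IsScalarTower R B B] [SMulCommClass R B B] : NonUnitalSubalgebra R B :=
  NonUnitalAlgebra.adjoin R {x : B | IsIdempotentElem x ∨ ∃ y z : B, x = ⁅y, z⁆}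

/-- `[x, B] ⊆ Z(B)` implies `x ∈ Z(B)`, for each `x` in `B`
(no nonzero inner derivation of `B` is central). -/
def NoCentralInnerDerivation (B : Type*) [NonUnitalRing B] : Prop :=
  ∀ x : B, (∀ y : B, ⁅x, y⁆ ∈ Set.center B) → x ∈ Set.center B

/-- The only two-sided ideal of `B` contained in the centre of `B` is zero. -/
def NoNonzeroCentralIdeal (B : Type*) [NonUnitalRing B] : Prop :=
  ∀ I : TwoSidedIdeal B, (∀ x ∈ I, x ∈ Set.center B) → I = ⊥

end Intrinsic

section Conditions

variable {R A : Type*} [CommRing R] [Ring A] [Algebra R A]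

/-- A Jordan derivation `δ` with `δ(eAe) = 0`, `δ(fAf) = 0`, `δ(eAf) ⊆ fAe`, `δ(fAe) ⊆ eAf`. -/
def IsSingularJordanDerivation (e f : A) (δ : A →ₗ[R] A) : Prop :=
  IsJordanDerivationMap δ ∧
    (∀ a ∈ peirceComp e e, δ a = 0) ∧ (∀ b ∈ peirceComp f f, δ b = 0) ∧
    (∀ m ∈ peirceComp e f, δ m ∈ peirceComp f e) ∧ (∀ t ∈ peirceComp f e, δ t ∈ peirceComp e f)

/-- `gAg = S(gAg)`. -/
def CornerGenerated (R : Type*) {A : Type*} [CommRing R] [Ring A] [Algebra R A] (g : A) : Prop :=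
  idemCommSubalgebra R (corner R g) = ⊤

/-- `Z(gAg) = gZ(A)g`, as subsets of `A`. -/
def CornerCenterEq (R : Type*) {A : Type*} [CommRing R] [Ring A] [Algebra R A] (g : A) : Prop :=
  Subtype.val '' Set.center (corner R g) = cornerOfCenter g

/-- `fφ(eAe)f ⊆ fZ(A)f` and `eφ(fAf)e ⊆ eZ(A)e`. -/
def CornersCentral (e f : A) (φ : A →ₗ[R] A) : Prop :=
  (∀ a ∈ peirceComp e e, f * φ a * f ∈ cornerOfCenter f) ∧
    (∀ b ∈ peirceComp f f, e * φ b * e ∈ cornerOfCenter e)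

end Conditions

section Sequences

variable {A : Type*} [Ring A]

/-- `lieSeq s k = p_{k+1}(s 0, …, s k)`. -/
def lieSeq (s : ℕ → A) : ℕ → A
  | 0 => s 0
  | k + 1 => ⁅lieSeq s k, s (k + 1)⁆

/-- The sum of the values obtained from `lieSeq s k` by applying `φ` to one of the entries. -/
def lieSeqDer (φ : A → A) (s : ℕ → A) : ℕ → A
  | 0 => φ (s 0)
  | k + 1 => ⁅lieSeqDer φ s k, s (k + 1)⁆ + ⁅lieSeq s k, φ (s (k + 1))⁆

theorem lieP_succ_succ (k : ℕ) (x : Fin (k + 2) → A) :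
    lieP (k + 2) x = ⁅lieP (k + 1) (fun i => x i.castSucc), x (Fin.last (k + 1))⁆ := rfl

theorem lieP_eq_lieSeq (s : ℕ → A) (k : ℕ) :
    lieP (k + 1) (fun i : Fin (k + 1) => s i) = lieSeq s k := by
  induction k with
  | zero => rfl
  | succ k ih =>
    rw [lieP_succ_succ, lieSeq, ← ih]
    rfl

theorem sum_lieP_update (φ : A → A) (s : ℕ → A) (k : ℕ) :
    ∑ i : Fin (k + 1), lieP (k + 1) (Function.update (fun i : Fin (k + 1) => s i) i (φ (s i)))
      = lieSeqDer φ s k := by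
  induction k with
  | zero => simp [lieP, lieSeqDer]
  | succ k ih =>
    rw [Fin.sum_univ_castSucc, lieSeqDer, ← ih]
    congr 1
    · rw [Ring.lie_def, Finset.sum_mul, Finset.mul_sum, ← Finset.sum_sub_distrib]
      refine Finset.sum_congr rfl fun i _ => ?_
      rw [lieP_succ_succ, ← Ring.lie_def]
      congr 2
      · funext j
        by_cases h : j = i
        · subst h; simp
        · rw [Function.update_of_ne h, Function.update_of_ne (by simpa using h)]
          rfl
      · rw [Function.update_of_ne (Fin.castSucc_lt_last i).ne']
        rfl
    · rw [lieP_succ_succ, ← lieP_eq_lieSeq]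
      congr 1
      · congr 1
        funext j
        rw [Function.update_of_ne (Fin.castSucc_lt_last j).ne]
        rfl
      · simp

theorem exists_seq_eq {k : ℕ} (x : Fin (k + 1) → A) :
    ∃ s : ℕ → A, x = fun i : Fin (k + 1) => s i :=
  ⟨fun i => if h : i < k + 1 then x ⟨i, h⟩ else 0, by funext i; simp only [dif_pos i.is_lt]⟩

theorem lieSeqDer_add (φ ψ : A → A) (s : ℕ → A) (k : ℕ) :
    lieSeqDer (φ + ψ) s k = lieSeqDer φ s k + lieSeqDer ψ s k := by
  induction k with
  | zero => rfl
  | succ k ih =>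
    simp only [lieSeqDer, ih, Pi.add_apply, Ring.lie_def]
    noncomm_ring

theorem lieSeqDer_zero (s : ℕ → A) (k : ℕ) : lieSeqDer (0 : A → A) s k = 0 := by
  induction k with
  | zero => rfl
  | succ k ih => simp [lieSeqDer, ih, Ring.lie_def]

theorem lieSeqDer_of_central {γ : A → A} (hγ : ∀ x, γ x ∈ Set.center A) (s : ℕ → A) (k : ℕ) :
    lieSeqDer γ s (k + 1) = 0 := by
  have hz : ∀ z ∈ Set.center A, ∀ x : A, ⁅z, x⁆ = 0 ∧ ⁅x, z⁆ = 0 := fun z hz x => by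
    have := (Set.mem_center_iff.1 hz).comm x
    simp [Ring.lie_def, this.eq]
  induction k with
  | zero => simp [lieSeqDer, (hz _ (hγ _) _).1, (hz _ (hγ _) _).2]
  | succ k ih =>
    rw [lieSeqDer, ih, (hz _ (hγ _) _).2]
    simp [Ring.lie_def]

end Sequences

section SequencesOfMaps

variable {R A : Type*} [CommRing R] [Ring A] [Algebra R A]

theorem isLieNDerivation_succ_iff {k : ℕ} {φ : A →ₗ[R] A} :
    IsLieNDerivation (k + 1) φ ↔ ∀ s : ℕ → A, φ (lieSeq s k) = lieSeqDer φ s k := by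
  constructor
  · intro h s
    rw [← lieP_eq_lieSeq, h, ← sum_lieP_update]
  · intro h x
    obtain ⟨s, rfl⟩ := exists_seq_eq x
    rw [lieP_eq_lieSeq, h, ← sum_lieP_update]

theorem IsDerivationMap.lieSeq {d : A →ₗ[R] A} (hd : IsDerivationMap d) (s : ℕ → A) (k : ℕ) :
    d (lieSeq s k) = lieSeqDer d s k := by
  induction k with
  | zero => rfl
  | succ k ih =>
    rw [_root_.lieSeq, lieSeqDer, ← ih]
    simp only [Ring.lie_def, map_sub, hd _ _]
    noncomm_ring

theorem IsJordanDerivationMap.lie_lie {δ : A →ₗ[R] A} (hδ : IsJordanDerivationMap δ) (x y z : A) :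
    δ ⁅⁅x, y⁆, z⁆ = ⁅⁅δ x, y⁆, z⁆ + ⁅⁅x, δ y⁆, z⁆ + ⁅⁅x, y⁆, δ z⁆ := by
  have h : ⁅⁅x, y⁆, z⁆ = (x * (y * z + z * y) + (y * z + z * y) * x)
      - (y * (x * z + z * x) + (x * z + z * x) * y) := by
    simp only [Ring.lie_def]; noncomm_ring
  rw [h, map_sub, hδ x, hδ y (x * z + z * x), hδ y z, hδ x z]
  simp only [Ring.lie_def]
  noncomm_ring

theorem IsJordanDerivationMap.lieSeq {δ : A →ₗ[R] A} (hδ : IsJordanDerivationMap δ) (s : ℕ → A)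
    (k : ℕ) : δ (lieSeq s (2 * k)) = lieSeqDer δ s (2 * k) := by
  induction k with
  | zero => rfl
  | succ k ih =>
    have h : 2 * (k + 1) = 2 * k + 1 + 1 := by ring
    rw [h, _root_.lieSeq, _root_.lieSeq, hδ.lie_lie, lieSeqDer, lieSeqDer, ← ih, _root_.lieSeq]
    simp only [Ring.lie_def]
    noncomm_ring

end SequencesOfMaps

section PeirceDecomposition

variable {A : Type*} [Ring A]

/-- Complementary orthogonal idempotents `e`, `f` satisfying the faithfulness condition. -/
structure PeirceSetup (e f : A) : Prop where
  ee : e * e = e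
  ff : f * f = f
  ef : e * f = 0
  fe : f * e = 0
  add : e + f = 1
  faithful : PeirceFaithful e f

namespace PeirceSetup

variable {e f : A}

theorem of_isIdempotentElem (he : IsIdempotentElem e) (hf : f = 1 - e) (hA : PeirceFaithful e f) :
    PeirceSetup e f := by
  have he' : e * e = e := he
  refine ⟨he', ?_, ?_, ?_, ?_, hA⟩ <;> subst hf <;> simp [mul_sub, sub_mul, he']

theorem symm (h : PeirceSetup e f) : PeirceSetup f e :=
  ⟨h.ff, h.ee, h.fe, h.ef, by rw [add_comm, h.add],
    fun x => ⟨fun h1 h2 => (h.faithful x).2 h2 h1, fun h1 h2 => (h.faithful x).1 h2 h1⟩⟩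

/-- Rewriting rules bringing expressions in `e`, `f` to normal form. -/
theorem rules (h : PeirceSetup e f) :
    e * e = e ∧ f * f = f ∧ e * f = 0 ∧ f * e = 0 ∧ (∀ x, e * (e * x) = e * x) ∧
      (∀ x, f * (f * x) = f * x) ∧ (∀ x, e * (f * x) = 0) ∧ (∀ x, f * (e * x) = 0) ∧
      (∀ x y z : A, x * y * z = x * (y * z)) ∧ (∀ x y z : A, x * (y + z) = x * y + x * z) ∧
      (∀ x y z : A, (x + y) * z = x * z + y * z) ∧ (∀ x y z : A, x * (y - z) = x * y - x * z) ∧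
      (∀ x y z : A, (x - y) * z = x * z - y * z) ∧ (∀ x y : A, x * -y = -(x * y)) ∧
      (∀ x y : A, -x * y = -(x * y)) ∧ (∀ x : A, x * 0 = 0) ∧ (∀ x : A, 0 * x = 0) := by
  refine ⟨h.ee, h.ff, h.ef, h.fe, ?_, ?_, ?_, ?_, mul_assoc, mul_add, fun x y z => add_mul x y z,
    mul_sub, fun x y z => sub_mul x y z, mul_neg, neg_mul, mul_zero, zero_mul⟩ <;>
    intro x <;> rw [← mul_assoc] <;> simp [h.ee, h.ff, h.ef, h.fe]

theorem decomp (h : PeirceSetup e f) (x : A) :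
    x = e * x * e + e * x * f + f * x * e + f * x * f := by
  calc x = (e + f) * x * (e + f) := by rw [h.add, one_mul, mul_one]
    _ = _ := by noncomm_ring

theorem eq_of_sandwich (h : PeirceSetup e f) {x y : A} (h1 : e * x * e = e * y * e)
    (h2 : e * x * f = e * y * f) (h3 : f * x * e = f * y * e) (h4 : f * x * f = f * y * f) :
    x = y := by
  rw [h.decomp x, h.decomp y, h1, h2, h3, h4]

theorem eq_zero_of_mul (h : PeirceSetup e f) {a : A} (ha : a ∈ peirceComp e e)
    (h1 : ∀ m ∈ peirceComp e f, a * m = 0) (h2 : ∀ t ∈ peirceComp f e, t * a = 0) : a = 0 := by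
  obtain ⟨x, rfl⟩ := ha
  exact (h.faithful x).1 h1 h2

theorem mem_center_of (h : PeirceSetup e f) {a b : A} (ha : a ∈ peirceComp e e)
    (hb : b ∈ peirceComp f f) (h1 : ∀ m ∈ peirceComp e f, a * m = m * b)
    (h2 : ∀ t ∈ peirceComp f e, t * a = b * t) : a + b ∈ Set.center A := by
  obtain ⟨a, rfl⟩ := ha
  obtain ⟨b, rfl⟩ := hb
  simp only at h1 h2
  have k1 : ∀ x, e * a * e * (e * x * f) = (e * x * f) * (f * b * f) := fun x => h1 _ ⟨x, rfl⟩
  have k2 : ∀ x, (f * x * e) * (e * a * e) = (f * b * f) * (f * x * e) := fun x => h2 _ ⟨x, rfl⟩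
  simp only [h.rules] at k1 k2
  rw [Semigroup.mem_center_iff]
  intro x
  have k3 : e * x * e * (e * a * e) - e * a * e * (e * x * e) = 0 := by
    refine h.eq_zero_of_mul ⟨x * e * a - a * e * x, by simp only [h.rules]⟩ ?_ ?_
    · rintro _ ⟨y, rfl⟩
      have l1 := k1 (x * e * y)
      have l2 := k1 y
      simp only [h.rules] at l1 l2 ⊢
      rw [l1, l2, sub_self]
    · rintro _ ⟨y, rfl⟩
      have l1 := k2 (y * e * x)
      have l2 := congrArg (· * (x * e)) (k2 y)
      simp only [h.rules] at l1 l2 ⊢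
      rw [l1, l2, sub_self]
  have k4 : f * x * f * (f * b * f) - f * b * f * (f * x * f) = 0 := by
    refine h.symm.eq_zero_of_mul ⟨x * f * b - b * f * x, by simp only [h.rules]⟩ ?_ ?_
    · rintro _ ⟨y, rfl⟩
      have l1 := k2 (x * f * y)
      have l2 := k2 y
      simp only [h.rules] at l1 l2 ⊢
      rw [← l1, ← l2, sub_self]
    · rintro _ ⟨y, rfl⟩
      have l1 := k1 (y * f * x)
      have l2 := congrArg (· * (x * f)) (k1 y)
      simp only [h.rules] at l1 l2 ⊢
      rw [← l1, ← l2, sub_self]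
  rw [sub_eq_zero] at k3 k4
  simp only [h.rules] at k3 k4
  apply h.eq_of_sandwich
  · simpa only [h.rules, add_zero, zero_add] using k3
  · simpa only [h.rules, add_zero, zero_add] using (k1 x).symm
  · simpa only [h.rules, add_zero, zero_add] using k2 x
  · simpa only [h.rules, add_zero, zero_add] using k4

theorem center_comm {z : A} (hz : z ∈ Set.center A) (x : A) : z * x = x * z :=
  (Semigroup.mem_center_iff.1 hz x).symm

theorem center_sandwich (h : PeirceSetup e f) {z : A} (hz : z ∈ Set.center A) :
    e * z * f = 0 := by
  rw [← center_comm hz, mul_assoc, h.ef, mul_zero]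

theorem center_eq (h : PeirceSetup e f) {z : A} (hz : z ∈ Set.center A) :
    z = e * z * e + f * z * f := by
  have := h.decomp z
  rw [h.center_sandwich hz, h.symm.center_sandwich hz] at this
  simpa using this

/-- A central element with vanishing `f`-corner vanishes. -/
theorem center_eq_zero (h : PeirceSetup e f) {z : A} (hz : z ∈ Set.center A)
    (h0 : f * z * f = 0) : z = 0 := by
  have h1 := h.center_eq hz
  rw [h0, add_zero] at h1
  refine h.eq_zero_of_mul ⟨z, h1.symm⟩ ?_ ?_
  · rintro _ ⟨x, rfl⟩
    rw [center_comm hz, h1]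
    simp only [h.rules]
  · rintro _ ⟨x, rfl⟩
    rw [← center_comm hz, h1]
    simp only [h.rules]

theorem center_eq_zero_of_mem (h : PeirceSetup e f) {z : A} (hz : z ∈ Set.center A)
    (h0 : z ∈ peirceComp e e) : z = 0 := by
  refine h.center_eq_zero hz ?_
  obtain ⟨x, rfl⟩ := h0
  simp only [h.rules]

end PeirceSetup

end PeirceDecomposition

section AdPow

variable {A : Type*} [Ring A]

/-- `adPow f k x = [[x, f], …, f]` with `k` brackets. -/
def adPow (f : A) : ℕ → A → A
  | 0, x => x
  | k + 1, x => ⁅adPow f k x, f⁆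

theorem adPow_zero_right (f : A) (k : ℕ) : adPow f k 0 = 0 := by
  induction k with
  | zero => rfl
  | succ k ih => simp [adPow, ih, Ring.lie_def]

theorem adPow_lie (f : A) (k : ℕ) (x : A) : adPow f k ⁅x, f⁆ = adPow f (k + 1) x := by
  induction k with
  | zero => rfl
  | succ k ih => rw [adPow, ih]; rfl

theorem lieSeq_pair (f x y : A) (k : ℕ) :
    lieSeq (fun | 0 => x | 1 => y | _ + 2 => f) (k + 1) = adPow f k ⁅x, y⁆ := by
  induction k with
  | zero => rfl
  | succ k ih => rw [lieSeq, ih]; rfl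

theorem lieSeqDer_pair {φ : A → A} {f x y : A}
    (hφ : ∀ k, ⁅adPow f k ⁅x, y⁆, φ f⁆ = 0) (k : ℕ) :
    lieSeqDer φ (fun | 0 => x | 1 => y | _ + 2 => f) (k + 1)
      = adPow f k (⁅φ x, y⁆ + ⁅x, φ y⁆) := by
  induction k with
  | zero => rfl
  | succ k ih =>
    rw [lieSeqDer, ih, lieSeq_pair]
    simp only [hφ, add_zero]
    rfl

namespace PeirceSetup

variable {e f : A}

theorem adPow_ef (h : PeirceSetup e f) (k : ℕ) (x : A) : e * adPow f k x * f = e * x * f := by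
  induction k with
  | zero => rfl
  | succ k ih =>
    rw [← ih, adPow, Ring.lie_def]
    simp only [h.rules, sub_zero]

theorem adPow_fe (h : PeirceSetup e f) (k : ℕ) (x : A) :
    f * adPow f k x * e = (-1 : ℤ) ^ k • (f * x * e) := by
  induction k with
  | zero => simp [adPow]
  | succ k ih =>
    rw [pow_succ, mul_comm, mul_smul, ← ih, adPow, Ring.lie_def]
    simp only [h.rules, zero_sub, neg_smul, one_smul]

theorem adPow_succ_ee (h : PeirceSetup e f) (k : ℕ) (x : A) : e * adPow f (k + 1) x * e = 0 := by
  rw [adPow, Ring.lie_def]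
  simp only [h.rules, sub_self]

theorem adPow_succ_ff (h : PeirceSetup e f) (k : ℕ) (x : A) : f * adPow f (k + 1) x * f = 0 := by
  rw [adPow, Ring.lie_def]
  simp only [h.rules, sub_self]

theorem adPow_of_mem (h : PeirceSetup e f) (k : ℕ) {m : A} (hm : m ∈ peirceComp e f) :
    adPow f k m = m := by
  induction k with
  | zero => rfl
  | succ k ih =>
    obtain ⟨x, rfl⟩ := hm
    rw [adPow, ih, Ring.lie_def]
    simp only [h.rules, sub_zero]

theorem adPow_eq (h : PeirceSetup e f) (k : ℕ) {x : A} (h1 : e * x * e = 0) (h2 : f * x * f = 0) :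
    adPow f k x = e * x * f + (-1 : ℤ) ^ k • (f * x * e) := by
  have h3 := h.decomp x
  rw [h1, h2, zero_add, add_zero] at h3
  induction k with
  | zero => simpa [adPow] using h3
  | succ k ih =>
    rw [adPow, ih, Ring.lie_def, pow_succ, mul_comm, mul_smul]
    rcases neg_one_pow_eq_or ℤ k with hk | hk <;>
      simp only [hk, h.rules, neg_smul, one_smul] <;> abel

end PeirceSetup

end AdPow

section LieNDerivations

variable {R A : Type*} [CommRing R] [Ring A] [Algebra R A] {e f : A} {φ : A →ₗ[R] A} {k : ℕ}

namespace IsLieNDerivation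

theorem adPow_of_lie_eq_zero (hφ : IsLieNDerivation (k + 2) φ) {x y : A} (hxy : ⁅x, y⁆ = 0)
    (f : A) : adPow f k (⁅φ x, y⁆ + ⁅x, φ y⁆) = 0 := by
  have h := isLieNDerivation_succ_iff.1 hφ (fun | 0 => x | 1 => y | _ + 2 => f)
  rw [lieSeq_pair, lieSeqDer_pair (fun k => by rw [hxy, adPow_zero_right]; simp [Ring.lie_def]),
    hxy, adPow_zero_right, map_zero] at h
  exact h.symm

theorem map_one_mem_center (hφ : IsLieNDerivation (k + 2) φ) (h : PeirceSetup e f) :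
    φ 1 ∈ Set.center A := by
  have key : ∀ y g : A, adPow g k ⁅φ 1, y⁆ = 0 := fun y g => by
    simpa [Ring.lie_def] using hφ.adPow_of_lie_eq_zero (x := 1) (y := y) (by simp [Ring.lie_def]) g
  have h1 : e * φ 1 * f = 0 := by
    have := congrArg (fun x => e * x * f) (key f f)
    simp only [h.adPow_ef, Ring.lie_def] at this
    simpa only [h.rules, sub_zero] using this
  have h2 : f * φ 1 * e = 0 := by
    have := congrArg (fun x => f * x * e) (key e e)
    simp only [h.symm.adPow_ef, Ring.lie_def] at this
    simpa only [h.rules, sub_zero] using this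
  have h3 := h.decomp (φ 1)
  rw [h1, h2, add_zero, add_zero] at h3
  rw [h3]
  refine h.mem_center_of ⟨_, rfl⟩ ⟨_, rfl⟩ ?_ ?_
  · rintro _ ⟨x, rfl⟩
    have := congrArg (fun x => e * x * f) (key (e * x * f) f)
    simp only [h.adPow_ef, Ring.lie_def] at this
    simp only [h.rules, sub_eq_zero] at this ⊢
    exact this
  · rintro _ ⟨x, rfl⟩
    have := congrArg (fun x => f * x * e) (key (f * x * e) e)
    simp only [h.symm.adPow_ef, Ring.lie_def] at this
    simp only [h.rules, sub_eq_zero] at this ⊢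
    exact this.symm

theorem map_mem_center_symm (hφ : IsLieNDerivation (k + 2) φ) (h : PeirceSetup e f)
    (hf : φ f ∈ Set.center A) : φ e ∈ Set.center A := by
  have h2 : φ e = φ 1 - φ f := by rw [← h.add, map_add]; abel
  rw [h2, sub_eq_add_neg]
  exact Set.add_mem_center (hφ.map_one_mem_center h) (Set.neg_mem_center hf)

theorem lie_map_eq_zero (hφ : IsLieNDerivation (k + 2) φ) (h : PeirceSetup e f)
    (hk : IsTorsionFreeBy A (k + 1)) (h1 : e * φ f * f = 0) (h2 : f * φ f * e = 0) {m : A}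
    (hm : m ∈ peirceComp e f) : ⁅m, φ f⁆ = 0 := by
  have hc : ⁅m, φ f⁆ ∈ peirceComp e f := by
    have h3 := h.decomp (φ f)
    rw [h1, h2, add_zero, add_zero] at h3
    obtain ⟨x, rfl⟩ := hm
    rw [h3, Ring.lie_def]
    exact ⟨x * f * φ f - φ f * e * x, by simp only [h.rules, add_zero, zero_add]⟩
  have hP : ∀ j, lieSeq (fun | 0 => m | _ + 1 => f) j = m := by
    intro j
    induction j with
    | zero => rfl
    | succ j ih =>
      rw [lieSeq, ih]
      exact h.adPow_of_mem 1 hm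
  have hD : ∀ j, lieSeqDer φ (fun | 0 => m | _ + 1 => f) j = adPow f j (φ m) + j • ⁅m, φ f⁆ := by
    intro j
    induction j with
    | zero => simp [lieSeqDer, adPow]
    | succ j ih =>
      have h4 : ⁅j • ⁅m, φ f⁆, f⁆ = j • ⁅m, φ f⁆ := by
        rw [Ring.lie_def, smul_mul_assoc, mul_smul_comm, ← smul_sub]
        congr 1
        exact h.adPow_of_mem 1 hc
      rw [lieSeqDer, ih, hP, succ_nsmul, ← add_assoc, adPow]
      simp only
      congr 1
      nth_rw 2 [← h4]
      simp only [Ring.lie_def, add_mul, mul_add]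
      abel
  have h5 := isLieNDerivation_succ_iff.1 hφ (fun | 0 => m | _ + 1 => f)
  rw [hP, hD] at h5
  apply hk
  have h6 := congrArg (fun x => e * x * f) h5
  simp only [mul_add, add_mul, h.adPow_ef, left_eq_add] at h6
  obtain ⟨y, hy⟩ := hc
  rw [← hy] at h6 ⊢
  simpa only [mul_smul_comm, smul_mul_assoc, h.rules] using h6

theorem map_mem_center (hφ : IsLieNDerivation (k + 2) φ) (h : PeirceSetup e f)
    (hk : IsTorsionFreeBy A (k + 1)) (h1 : e * φ f * f = 0) (h2 : f * φ f * e = 0) :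
    φ f ∈ Set.center A := by
  have hone := hφ.map_one_mem_center h
  have he : φ e = φ 1 - φ f := by rw [← h.add, map_add]; abel
  have key : ∀ t ∈ peirceComp f e, ⁅t, φ f⁆ = 0 := fun t ht => by
    have h3 : ⁅t, φ e⁆ = 0 := by
      refine hφ.lie_map_eq_zero h.symm hk ?_ ?_ ht
      · rw [he, mul_sub, sub_mul, h2, h.symm.center_sandwich hone, sub_zero]
      · rw [he, mul_sub, sub_mul, h1, h.center_sandwich hone, sub_zero]
    rw [he, Ring.lie_def, mul_sub, sub_mul, PeirceSetup.center_comm hone] at h3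
    rw [Ring.lie_def, ← neg_eq_zero, ← h3]
    abel
  have h3 := h.decomp (φ f)
  rw [h1, h2, add_zero, add_zero] at h3
  rw [h3]
  refine h.mem_center_of ⟨_, rfl⟩ ⟨_, rfl⟩ ?_ ?_
  · rintro _ ⟨x, rfl⟩
    have h4 := hφ.lie_map_eq_zero h hk h1 h2 ⟨x, rfl⟩
    have := congrArg (fun x => e * x * f) h4
    simp only [Ring.lie_def] at this
    simp only [h.rules, sub_eq_zero] at this ⊢
    exact this.symm
  · rintro _ ⟨x, rfl⟩
    have h4 := key _ ⟨x, rfl⟩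
    have := congrArg (fun x => f * x * e) h4
    simp only [Ring.lie_def] at this
    simp only [h.rules, sub_eq_zero] at this ⊢
    exact this

theorem lie_center {z : A} (hz : z ∈ Set.center A) (x : A) : ⁅x, z⁆ = 0 := by
  rw [Ring.lie_def, PeirceSetup.center_comm hz, sub_self]

theorem map_adPow_lie (hφ : IsLieNDerivation (k + 2) φ) (hf : φ f ∈ Set.center A) (x y : A) :
    φ (adPow f k ⁅x, y⁆) = adPow f k (⁅φ x, y⁆ + ⁅x, φ y⁆) := by
  rw [← lieSeq_pair, isLieNDerivation_succ_iff.1 hφ, lieSeqDer_pair fun k => lie_center hf _]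

theorem map_lie_adPow (hφ : IsLieNDerivation (k + 2) φ) (hf : φ f ∈ Set.center A) (x y : A) :
    φ ⁅adPow f k x, y⁆ = ⁅adPow f k (φ x), y⁆ + ⁅adPow f k x, φ y⁆ := by
  have hP : ∀ j ≤ k,
      lieSeq (fun i => if i = 0 then x else if i = k + 1 then y else f) j = adPow f j x := by
    intro j hj
    induction j with
    | zero => rfl
    | succ j ih =>
      rw [lieSeq, ih (by omega), if_neg (by omega), if_neg (by omega), adPow]
  have hD : ∀ j ≤ k, lieSeqDer φ (fun i => if i = 0 then x else if i = k + 1 then y else f) j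
      = adPow f j (φ x) := by
    intro j hj
    induction j with
    | zero => rfl
    | succ j ih =>
      rw [lieSeqDer, ih (by omega), if_neg (by omega), if_neg (by omega), lie_center hf, add_zero,
        adPow]
  have h := isLieNDerivation_succ_iff.1 hφ
    (fun i => if i = 0 then x else if i = k + 1 then y else f)
  rw [lieSeq, lieSeqDer, hP k le_rfl, hD k le_rfl] at h
  simpa using h

end IsLieNDerivation

end LieNDerivations

section Relations

variable {R A : Type*} [CommRing R] [Ring A] [Algebra R A]

/-- The relations between the Peirce components of a Lie `n`-derivation `φ` with `φ e`, `φ f`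
central that involve `eAe`, `eAf`; the others are those of `PeirceRel f e φ`. -/
structure PeirceRel (e f : A) (φ : A →ₗ[R] A) : Prop where
  diag : ∀ a ∈ peirceComp e e, e * φ a * f = 0 ∧ f * φ a * e = 0
  off : ∀ m ∈ peirceComp e f, e * φ m * e = 0 ∧ f * φ m * f = 0
  left_mul : ∀ a ∈ peirceComp e e, ∀ m ∈ peirceComp e f,
    e * φ (a * m) * f = e * φ a * e * m - m * (f * φ a * f) + a * (e * φ m * f)
  left_mul' : ∀ a ∈ peirceComp e e, ∀ m ∈ peirceComp e f, f * φ (a * m) * e = f * φ m * e * a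
  mul_right : ∀ m ∈ peirceComp e f, ∀ b ∈ peirceComp f f,
    e * φ (m * b) * f = e * φ m * f * b + m * (f * φ b * f) - e * φ b * e * m
  mul_right' : ∀ m ∈ peirceComp e f, ∀ b ∈ peirceComp f f,
    f * φ (m * b) * e = b * (f * φ m * e)
  skew : ∀ m ∈ peirceComp e f, ∀ m' ∈ peirceComp e f,
    m' * (f * φ m * e) + m * (f * φ m' * e) = 0 ∧ f * φ m * e * m' + f * φ m' * e * m = 0
  lie : ∀ m ∈ peirceComp e f, ∀ t ∈ peirceComp f e,
    φ (m * t) - φ (t * m) = e * φ m * f * t - t * (e * φ m * f)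
      + (m * (f * φ t * e) - f * φ t * e * m)

variable {e f : A} {φ : A →ₗ[R] A} {k : ℕ}

namespace IsLieNDerivation

theorem off_diagonal (hφ : IsLieNDerivation (k + 2) φ) (h : PeirceSetup e f)
    (hf : φ f ∈ Set.center A) {m : A} (hm : m ∈ peirceComp e f) :
    φ m = adPow f (k + 1) (φ m) := by
  have h1 := hφ.map_adPow_lie hf m f
  rwa [lie_center hf, add_zero, adPow_lie, adPow_lie, h.adPow_of_mem _ hm] at h1

theorem neg_one_pow_smul (hφ : IsLieNDerivation (k + 2) φ) (h : PeirceSetup e f)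
    (hf : φ f ∈ Set.center A) {m : A} (hm : m ∈ peirceComp e f) :
    (-1 : ℤ) ^ k • (f * φ m * e) = -(f * φ m * e) := by
  have h1 := congrArg (fun x => f * x * e) (hφ.off_diagonal h hf hm)
  simp only [h.adPow_fe] at h1
  rw [pow_succ, mul_comm, mul_smul, neg_smul, one_smul] at h1
  rw [← neg_eq_iff_eq_neg, ← h1]

theorem eq_zero_of_even (hφ : IsLieNDerivation (k + 2) φ) (h : PeirceSetup e f)
    (h2 : IsTorsionFreeBy A 2) (hf : φ f ∈ Set.center A) (hk : Even k) {m : A}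
    (hm : m ∈ peirceComp e f) : f * φ m * e = 0 := by
  have h1 := hφ.neg_one_pow_smul h hf hm
  rw [hk.neg_one_pow, one_smul] at h1
  apply h2
  rw [two_smul]
  nth_rw 1 [h1]
  rw [neg_add_cancel]

theorem peirceRel (hφ : IsLieNDerivation (k + 2) φ) (h : PeirceSetup e f)
    (hf : φ f ∈ Set.center A) : PeirceRel e f φ := by
  have hdiag : ∀ a ∈ peirceComp e e ∪ peirceComp f f,
      e * φ a * f = 0 ∧ f * φ a * e = 0 := by
    intro a ha
    have h0 : ⁅a, f⁆ = 0 := by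
      rcases ha with ⟨x, rfl⟩ | ⟨x, rfl⟩ <;>
        simp only [Ring.lie_def, h.rules, sub_self]
    have h1 := hφ.adPow_of_lie_eq_zero h0 f
    rw [lie_center hf, add_zero, adPow_lie] at h1
    have h2 := congrArg (fun x => e * x * f) h1
    have h3 := congrArg (fun x => f * x * e) h1
    simp only [h.adPow_ef, h.adPow_fe, mul_zero, zero_mul] at h2 h3
    refine ⟨h2, ?_⟩
    rcases neg_one_pow_eq_or ℤ (k + 1) with hk | hk <;> simpa [hk] using h3
  have hoff : ∀ m ∈ peirceComp e f, e * φ m * e = 0 ∧ f * φ m * f = 0 := fun m hm => by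
    rw [hφ.off_diagonal h hf hm]
    exact ⟨h.adPow_succ_ee _ _, h.adPow_succ_ff _ _⟩
  have hsum : ∀ m ∈ peirceComp e f, φ m = e * φ m * f + f * φ m * e := fun m hm => by
    have := h.decomp (φ m)
    rwa [(hoff m hm).1, (hoff m hm).2, zero_add, add_zero] at this
  have hdsum : ∀ a ∈ peirceComp e e ∪ peirceComp f f, φ a = e * φ a * e + f * φ a * f :=
    fun a ha => by
      have := h.decomp (φ a)
      rwa [(hdiag a ha).1, (hdiag a ha).2, add_zero, add_zero] at this
  have had : ∀ m ∈ peirceComp e f, adPow f k (φ m) = e * φ m * f - f * φ m * e := fun m hm => by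
    rw [h.adPow_eq k (hoff m hm).1 (hoff m hm).2, hφ.neg_one_pow_smul h hf hm, sub_eq_add_neg]
  have hlie : ∀ m ∈ peirceComp e f, ∀ y, φ ⁅m, y⁆ = ⁅e * φ m * f - f * φ m * e, y⁆ + ⁅m, φ y⁆ :=
    fun m hm y => by
      have := hφ.map_lie_adPow hf m y
      rwa [had m hm, h.adPow_of_mem _ hm] at this
  refine ⟨fun a ha => hdiag a (.inl ha), hoff, ?_, ?_, ?_, ?_, ?_, ?_⟩
  · intro a ha m hm
    have h1 := hlie m hm a
    have h0 := hdsum a (.inl ha)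
    obtain ⟨x, rfl⟩ := ha
    obtain ⟨y, rfl⟩ := hm
    have h2 : ⁅e * y * f, e * x * e⁆ = -(e * x * e * (e * y * f)) := by
      simp only [Ring.lie_def, h.rules, zero_sub]
    rw [h2, map_neg, h0] at h1
    have h3 := congrArg (fun z => -(e * z * f)) h1
    simp only [mul_neg, neg_mul, neg_neg] at h3
    rw [h3]
    simp only [Ring.lie_def, h.rules]
    abel
  · intro a ha m hm
    have h1 := hlie m hm a
    have h0 := hdsum a (.inl ha)
    obtain ⟨x, rfl⟩ := ha
    obtain ⟨y, rfl⟩ := hm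
    have h2 : ⁅e * y * f, e * x * e⁆ = -(e * x * e * (e * y * f)) := by
      simp only [Ring.lie_def, h.rules, zero_sub]
    rw [h2, map_neg, h0] at h1
    have h3 := congrArg (fun z => -(f * z * e)) h1
    simp only [mul_neg, neg_mul, neg_neg] at h3
    rw [h3]
    simp only [Ring.lie_def, h.rules]
    abel
  · intro m hm b hb
    have h1 := hlie m hm b
    have h0 := hdsum b (.inr hb)
    obtain ⟨x, rfl⟩ := hb
    obtain ⟨y, rfl⟩ := hm
    have h2 : ⁅e * y * f, f * x * f⁆ = e * y * f * (f * x * f) := by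
      simp only [Ring.lie_def, h.rules, sub_zero]
    rw [h2, h0] at h1
    rw [h1]
    simp only [Ring.lie_def, h.rules]
    abel
  · intro m hm b hb
    have h1 := hlie m hm b
    have h0 := hdsum b (.inr hb)
    obtain ⟨x, rfl⟩ := hb
    obtain ⟨y, rfl⟩ := hm
    have h2 : ⁅e * y * f, f * x * f⁆ = e * y * f * (f * x * f) := by
      simp only [Ring.lie_def, h.rules, sub_zero]
    rw [h2, h0] at h1
    rw [h1]
    simp only [Ring.lie_def, h.rules]
    abel
  · intro m hm m' hm'
    have h1 := hlie m hm m'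
    have h0 := hsum m' hm'
    obtain ⟨x, rfl⟩ := hm'
    obtain ⟨y, rfl⟩ := hm
    have h2 : ⁅e * y * f, e * x * f⁆ = 0 := by
      simp only [Ring.lie_def, h.rules, sub_zero]
    rw [h2, h0, map_zero] at h1
    constructor
    · have h3 := congrArg (fun z => e * z * e) h1
      simp only [Ring.lie_def, h.rules] at h3 ⊢
      rw [h3]
      abel
    · have h3 := congrArg (fun z => -(f * z * f)) h1
      simp only [Ring.lie_def, h.rules] at h3 ⊢
      rw [neg_zero] at h3
      rw [h3]
      abel
  · intro m hm t ht
    have h1 := hlie m hm t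
    have he := hφ.map_mem_center_symm h hf
    have h0 : φ t = e * φ t * f + f * φ t * e := by
      have h2 := h.decomp (φ t)
      have h3 := hφ.off_diagonal h.symm he ht
      have h4 : e * φ t * e = 0 := by rw [h3]; exact h.symm.adPow_succ_ff _ _
      have h5 : f * φ t * f = 0 := by rw [h3]; exact h.symm.adPow_succ_ee _ _
      rwa [h4, h5, zero_add, add_zero] at h2
    rw [← map_sub, ← Ring.lie_def, h1, h0]
    obtain ⟨x, rfl⟩ := hm
    obtain ⟨y, rfl⟩ := ht
    simp only [Ring.lie_def, h.rules]
    simp only [zero_add, sub_zero]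

end IsLieNDerivation

end Relations

section CornerConditions

variable {R A : Type*} [CommRing R] [Ring A] [Algebra R A] {e f : A} {φ : A →ₗ[R] A}

namespace PeirceSetup

theorem mem_cornerOfCenter (h : PeirceSetup e f) {b c : A} (hb : b ∈ peirceComp f f)
    (hc : c ∈ peirceComp e e) (h1 : ∀ m ∈ peirceComp e f, c * m = m * b)
    (h2 : ∀ t ∈ peirceComp f e, t * c = b * t) : b ∈ cornerOfCenter f := by
  refine ⟨c + b, h.mem_center_of hc hb h1 h2, ?_⟩
  obtain ⟨x, rfl⟩ := hb
  obtain ⟨y, rfl⟩ := hc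
  simp only [h.rules, zero_add]

theorem center_mul (h : PeirceSetup e f) {z m : A} (hz : z ∈ Set.center A)
    (hm : m ∈ peirceComp e f) : e * z * e * m = m * (f * z * f) := by
  obtain ⟨x, rfl⟩ := hm
  have h1 := center_comm hz (e * (x * f))
  have h2 := congrArg (e * ·) h1
  have h3 := congrArg (· * f) h1
  simp only [h.rules] at h1 h2 h3 ⊢
  rw [h2, h3.symm.trans h1]

theorem exists_of_mem_cornerOfCenter (h : PeirceSetup e f) {b : A} (hb : b ∈ cornerOfCenter f) :
    ∃ c ∈ peirceComp e e, (∀ m ∈ peirceComp e f, c * m = m * b) ∧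
      ∀ t ∈ peirceComp f e, t * c = b * t := by
  obtain ⟨z, hz, rfl⟩ := hb
  exact ⟨e * z * e, ⟨z, rfl⟩, fun m hm => h.center_mul hz hm,
    fun t ht => (h.symm.center_mul hz ht).symm⟩

theorem commute_of_mem_cornerOfCenter (h : PeirceSetup e f) {b c : A}
    (hb : b ∈ peirceComp f f) (hc : c ∈ cornerOfCenter f) : c * b = b * c := by
  obtain ⟨z, hz, rfl⟩ := hc
  obtain ⟨x, rfl⟩ := hb
  have h1 := center_comm hz (f * (x * f))
  have h2 := congrArg (f * ·) h1
  have h3 := congrArg (· * f) h1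
  simp only [h.rules] at h1 h2 h3 ⊢
  rw [h2, ← h3, h1]

end PeirceSetup

theorem CornerCenterEq.mem (hc : CornerCenterEq R f) {x : A} (hx : x ∈ peirceComp f f)
    (hcomm : ∀ b ∈ peirceComp f f, x * b = b * x) : x ∈ cornerOfCenter f := by
  rw [← hc]
  exact ⟨⟨x, hx⟩, Semigroup.mem_center_iff.2 fun b => Subtype.ext (hcomm b b.2).symm, rfl⟩

theorem NoCentralInnerDerivation.commute (hn : NoCentralInnerDerivation (corner R f)) {x : A}
    (hx : x ∈ peirceComp f f)
    (hc : ∀ y ∈ peirceComp f f, ∀ b ∈ peirceComp f f, ⁅x, y⁆ * b = b * ⁅x, y⁆) :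
    ∀ b ∈ peirceComp f f, x * b = b * x := by
  intro b hb
  have h1 := hn ⟨x, hx⟩ fun y => Semigroup.mem_center_iff.2 fun b =>
    Subtype.ext (hc y y.2 b b.2).symm
  exact congrArg Subtype.val (Semigroup.mem_center_iff.1 h1 ⟨b, hb⟩).symm

theorem mul_mem_peirceComp {g₁ g₂ g₃ x y : A} (hx : x ∈ peirceComp g₁ g₂)
    (hy : y ∈ peirceComp g₂ g₃) : x * y ∈ peirceComp g₁ g₃ := by
  obtain ⟨x, rfl⟩ := hx
  obtain ⟨y, rfl⟩ := hy
  exact ⟨x * g₂ * g₂ * y, by simp only [mul_assoc]⟩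

theorem add_mem_peirceComp {g₁ g₂ x y : A} (hx : x ∈ peirceComp g₁ g₂)
    (hy : y ∈ peirceComp g₁ g₂) : x + y ∈ peirceComp g₁ g₂ := by
  obtain ⟨x, rfl⟩ := hx
  obtain ⟨y, rfl⟩ := hy
  exact ⟨x + y, by simp only [mul_add, add_mul]⟩

theorem sub_mem_peirceComp {g₁ g₂ x y : A} (hx : x ∈ peirceComp g₁ g₂)
    (hy : y ∈ peirceComp g₁ g₂) : x - y ∈ peirceComp g₁ g₂ := by
  obtain ⟨x, rfl⟩ := hx
  obtain ⟨y, rfl⟩ := hy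
  exact ⟨x - y, by simp only [mul_sub, sub_mul]⟩

namespace PeirceRel

theorem lie_mul_eq (hr : PeirceRel e f φ) {a b m : A} (ha : a ∈ peirceComp e e)
    (hb : b ∈ peirceComp f f) (hm : m ∈ peirceComp e f) :
    ⁅a, e * φ b * e⁆ * m = m * ⁅f * φ a * f, b⁆ := by
  have h1 := hr.left_mul a ha (m * b) (mul_mem_peirceComp hm hb)
  have h2 := hr.mul_right (a * m) (mul_mem_peirceComp ha hm) b hb
  rw [hr.mul_right m hm b hb, ← mul_assoc, h2, hr.left_mul a ha m hm] at h1
  generalize e * φ b * e = pb, e * φ a * e = pa, f * φ a * f = qa, f * φ b * f = qb,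
    e * φ m * f = n at *
  rw [Ring.lie_def, Ring.lie_def]
  linear_combination (norm := noncomm_ring) h1

theorem lie_add_lie_mem_center (hr : PeirceRel e f φ) (hr' : PeirceRel f e φ)
    (h : PeirceSetup e f) {a b : A} (ha : a ∈ peirceComp e e) (hb : b ∈ peirceComp f f) :
    ⁅a, e * φ b * e⁆ + ⁅f * φ a * f, b⁆ ∈ Set.center A := by
  refine h.mem_center_of ?_ ?_ (fun m hm => hr.lie_mul_eq ha hb hm) fun t ht => ?_
  · exact sub_mem_peirceComp (mul_mem_peirceComp ha ⟨_, rfl⟩) (mul_mem_peirceComp ⟨_, rfl⟩ ha)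
  · exact sub_mem_peirceComp (mul_mem_peirceComp ⟨_, rfl⟩ hb) (mul_mem_peirceComp hb ⟨_, rfl⟩)
  · have h1 := hr'.lie_mul_eq hb ha ht
    simp only [Ring.lie_def] at h1 ⊢
    linear_combination (norm := noncomm_ring) h1

/-- The defect of `a ↦ e * φ a * e` from being a derivation of `eAe`. -/
theorem defect_mul (hr : PeirceRel e f φ) {a a' m : A} (ha : a ∈ peirceComp e e)
    (ha' : a' ∈ peirceComp e e) (hm : m ∈ peirceComp e f) :
    (e * φ (a * a') * e - e * φ a * e * a' - a * (e * φ a' * e)) * m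
      = m * (f * φ (a * a') * f) - a' * m * (f * φ a * f) - a * m * (f * φ a' * f) := by
  have h1 := hr.left_mul (a * a') (mul_mem_peirceComp ha ha') m hm
  have h2 := hr.left_mul a ha (a' * m) (mul_mem_peirceComp ha' hm)
  rw [hr.left_mul a' ha' m hm, ← mul_assoc, h1] at h2
  generalize e * φ (a * a') * e = p, e * φ a * e = pa, e * φ a' * e = pa', f * φ (a * a') * f = q,
    f * φ a * f = qa, f * φ a' * f = qa', e * φ m * f = n at *
  linear_combination (norm := noncomm_ring) h2

theorem mul_defect (hr : PeirceRel f e φ) {a a' t : A} (ha : a ∈ peirceComp e e)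
    (ha' : a' ∈ peirceComp e e) (ht : t ∈ peirceComp f e) :
    t * (e * φ (a * a') * e - e * φ a * e * a' - a * (e * φ a' * e))
      = f * φ (a * a') * f * t - f * φ a * f * t * a' - f * φ a' * f * t * a := by
  have h1 := hr.mul_right t ht (a * a') (mul_mem_peirceComp ha ha')
  have h2 := hr.mul_right (t * a) (mul_mem_peirceComp ht ha) a' ha'
  rw [hr.mul_right t ht a ha, mul_assoc t a a', h1] at h2
  generalize e * φ (a * a') * e = p, e * φ a * e = pa, e * φ a' * e = pa', f * φ (a * a') * f = q,
    f * φ a * f = qa, f * φ a' * f = qa', f * φ t * e = n at *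
  linear_combination (norm := noncomm_ring) h2

theorem mem_cornerOfCenter_of_commutator (hr : PeirceRel e f φ) (hr' : PeirceRel f e φ)
    (h : PeirceSetup e f) {a a' : A} (ha : a ∈ peirceComp e e) (ha' : a' ∈ peirceComp e e) :
    f * φ (a * a' - a' * a) * f ∈ cornerOfCenter f := by
  rw [map_sub]
  refine h.mem_cornerOfCenter (c := (e * φ (a * a') * e - e * φ a * e * a' - a * (e * φ a' * e))
    - (e * φ (a' * a) * e - e * φ a' * e * a - a' * (e * φ a * e))) ⟨_, rfl⟩ ?_ ?_ ?_
  · have hp : ∀ x, e * x * e ∈ peirceComp e e := fun x => ⟨x, rfl⟩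
    exact sub_mem_peirceComp (sub_mem_peirceComp (sub_mem_peirceComp (hp _)
      (mul_mem_peirceComp (hp _) ha')) (mul_mem_peirceComp ha (hp _)))
      (sub_mem_peirceComp (sub_mem_peirceComp (hp _)
      (mul_mem_peirceComp (hp _) ha)) (mul_mem_peirceComp ha' (hp _)))
  · intro m hm
    rw [sub_mul, hr.defect_mul ha ha' hm, hr.defect_mul ha' ha hm]
    noncomm_ring
  · intro t ht
    rw [mul_sub, hr'.mul_defect ha ha' ht, hr'.mul_defect ha' ha ht]
    noncomm_ring

theorem mem_cornerOfCenter_of_idempotent (hr : PeirceRel e f φ) (hr' : PeirceRel f e φ)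
    (h : PeirceSetup e f) {g : A} (hg : g ∈ peirceComp e e) (hgg : g * g = g) :
    f * φ g * f ∈ cornerOfCenter f := by
  have hp : ∀ x, e * x * e ∈ peirceComp e e := fun x => ⟨x, rfl⟩
  have hgx : ∀ x, g * (g * x) = g * x := fun x => by rw [← mul_assoc, hgg]
  refine h.mem_cornerOfCenter (c := (e * φ g * e - e * φ g * e * g - g * (e * φ g * e))
    + (g * (e * φ g * e) * g + g * (e * φ g * e) * g)) ⟨_, rfl⟩ ?_ ?_ ?_
  · exact add_mem_peirceComp (sub_mem_peirceComp (sub_mem_peirceComp (hp _)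
      (mul_mem_peirceComp (hp _) hg)) (mul_mem_peirceComp hg (hp _)))
      (add_mem_peirceComp (mul_mem_peirceComp (mul_mem_peirceComp hg (hp _)) hg)
      (mul_mem_peirceComp (mul_mem_peirceComp hg (hp _)) hg))
  · intro m hm
    have h1 := hr.defect_mul hg hg hm
    rw [hgg] at h1
    have h2 := congrArg (g * ·) h1
    generalize e * φ g * e = p, f * φ g * f = q at *
    simp only [mul_assoc, mul_sub, sub_mul, add_mul, hgx] at h1 h2 ⊢
    linear_combination (norm := noncomm_ring) h1 - 2 * h2
  · intro t ht
    have h1 := hr'.mul_defect hg hg ht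
    rw [hgg] at h1
    have h2 := congrArg (· * g) h1
    generalize e * φ g * e = p, f * φ g * f = q at *
    simp only [mul_assoc, mul_sub, sub_mul, mul_add, hgg] at h1 h2 ⊢
    linear_combination (norm := noncomm_ring) h1 - 2 * h2

theorem mem_cornerOfCenter_of_mul (hr : PeirceRel e f φ) (hr' : PeirceRel f e φ)
    (h : PeirceSetup e f) {a a' : A} (ha : a ∈ peirceComp e e) (ha' : a' ∈ peirceComp e e)
    (hc : f * φ a * f ∈ cornerOfCenter f) (hc' : f * φ a' * f ∈ cornerOfCenter f) :
    f * φ (a * a') * f ∈ cornerOfCenter f := by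
  have hp : ∀ x, e * x * e ∈ peirceComp e e := fun x => ⟨x, rfl⟩
  obtain ⟨c, h0, h1, h2⟩ := h.exists_of_mem_cornerOfCenter hc
  obtain ⟨c', h0', h1', h2'⟩ := h.exists_of_mem_cornerOfCenter hc'
  refine h.mem_cornerOfCenter
    (c := (e * φ (a * a') * e - e * φ a * e * a' - a * (e * φ a' * e))
      + (c * a' + c' * a)) ⟨_, rfl⟩ ?_ ?_ ?_
  · exact add_mem_peirceComp (sub_mem_peirceComp (sub_mem_peirceComp (hp _)
      (mul_mem_peirceComp (hp _) ha')) (mul_mem_peirceComp ha (hp _)))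
      (add_mem_peirceComp (mul_mem_peirceComp h0 ha') (mul_mem_peirceComp h0' ha))
  · intro m hm
    rw [add_mul, hr.defect_mul ha ha' hm, add_mul, mul_assoc c, mul_assoc c',
      h1 _ (mul_mem_peirceComp ha' hm), h1' _ (mul_mem_peirceComp ha hm)]
    abel
  · intro t ht
    rw [mul_add, hr'.mul_defect ha ha' ht, mul_add, ← mul_assoc t, ← mul_assoc t, h2 t ht, h2' t ht]
    abel

theorem cornerOfCenter_of_generated (hr : PeirceRel e f φ) (hr' : PeirceRel f e φ)
    (h : PeirceSetup e f) (hg : CornerGenerated R e) :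
    ∀ a ∈ peirceComp e e, f * φ a * f ∈ cornerOfCenter f := by
  intro a ha
  have h1 : (⟨a, ha⟩ : corner R e) ∈ idemCommSubalgebra R (corner R e) := by
    rw [hg]; trivial
  suffices ∀ x : corner R e, x ∈ idemCommSubalgebra R (corner R e) →
      f * φ x * f ∈ cornerOfCenter f from this _ h1
  intro x hx
  induction hx using NonUnitalAlgebra.adjoin_induction with
  | mem x hx =>
    rcases hx with hx | ⟨y, z, rfl⟩
    · exact hr.mem_cornerOfCenter_of_idempotent hr' h x.2 (congrArg Subtype.val hx)
    · exact hr.mem_cornerOfCenter_of_commutator hr' h y.2 z.2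
  | add x y _ _ hx hy =>
    obtain ⟨z, hz, hzx⟩ := hx
    obtain ⟨w, hw, hwy⟩ := hy
    refine ⟨z + w, Set.add_mem_center hz hw, ?_⟩
    simp only at hzx hwy
    simp only [mul_add, add_mul, hzx, hwy, NonUnitalSubalgebra.coe_add, map_add]
  | zero => exact ⟨0, Set.zero_mem_center, by simp⟩
  | mul x y _ _ hx hy => exact hr.mem_cornerOfCenter_of_mul hr' h x.2 y.2 hx hy
  | smul r x _ hx =>
    obtain ⟨z, hz, hzx⟩ := hx
    refine ⟨r • z, Set.smul_mem_center r hz, ?_⟩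
    simp only at hzx
    simp only [mul_smul_comm, smul_mul_assoc, hzx, NonUnitalSubalgebra.coe_smul, map_smul]

/-- If `eφ(b)e` commutes with `eAe` for all `b`, then `fφ(a)f` commutes with `fAf`. -/
theorem commute_of_commute (hr : PeirceRel e f φ) (hr' : PeirceRel f e φ) (h : PeirceSetup e f)
    (hc : ∀ b ∈ peirceComp f f, ∀ a ∈ peirceComp e e, e * φ b * e * a = a * (e * φ b * e)) :
    ∀ a ∈ peirceComp e e, ∀ b ∈ peirceComp f f, f * φ a * f * b = b * (f * φ a * f) := by
  intro a ha b hb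
  have h1 := hr.lie_add_lie_mem_center hr' h ha hb
  rw [Ring.lie_def a, hc b hb a ha, sub_self, zero_add] at h1
  have h2 := h.symm.center_eq_zero_of_mem h1
    (sub_mem_peirceComp (mul_mem_peirceComp ⟨_, rfl⟩ hb) (mul_mem_peirceComp hb ⟨_, rfl⟩))
  rwa [Ring.lie_def, sub_eq_zero] at h2

theorem cornersCentral_of_generated (hr : PeirceRel e f φ) (hr' : PeirceRel f e φ)
    (h : PeirceSetup e f) (hg : CornerGenerated R e) (hc : CornerCenterEq R e) :
    CornersCentral e f φ := by
  have h1 := hr.cornerOfCenter_of_generated hr' h hg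
  refine ⟨h1, fun b hb => hc.mem ⟨_, rfl⟩ ?_⟩
  exact hr'.commute_of_commute hr h.symm
    (fun a ha b hb => h.commute_of_mem_cornerOfCenter hb (h1 a ha)) b hb

theorem cornersCentral_of_commute (hr : PeirceRel e f φ) (hr' : PeirceRel f e φ)
    (h : PeirceSetup e f) (hc : CornerCenterEq R e) (hc' : CornerCenterEq R f)
    (h1 : ∀ b ∈ peirceComp f f, ∀ a ∈ peirceComp e e, e * φ b * e * a = a * (e * φ b * e)) :
    CornersCentral e f φ :=
  ⟨fun a ha => hc'.mem ⟨_, rfl⟩ (hr.commute_of_commute hr' h h1 a ha),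
    fun b hb => hc.mem ⟨_, rfl⟩ (h1 b hb)⟩

theorem cornersCentral_of_noCentralInnerDerivation (hr : PeirceRel e f φ) (hr' : PeirceRel f e φ)
    (h : PeirceSetup e f) (hn : NoCentralInnerDerivation (corner R e)) (hc : CornerCenterEq R e)
    (hc' : CornerCenterEq R f) : CornersCentral e f φ := by
  refine hr.cornersCentral_of_commute hr' h hc hc' ?_
  intro b hb
  refine hn.commute ⟨_, rfl⟩ fun a ha => ?_
  have h2 := PeirceSetup.center_comm (hr.lie_add_lie_mem_center hr' h ha hb)
  rintro _ ⟨y, rfl⟩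
  have h3 := h2 (e * y * e)
  have h4 : ⁅f * φ a * f, b⁆ * (e * y * e) = 0 ∧ (e * y * e) * ⁅f * φ a * f, b⁆ = 0 := by
    obtain ⟨b, rfl⟩ := hb
    simp only [Ring.lie_def, h.rules, sub_self, and_self]
  rw [add_mul, mul_add, h4.1, h4.2, add_zero, add_zero] at h3
  have h5 : ⁅e * φ b * e, a⁆ = -⁅a, e * φ b * e⁆ := by rw [Ring.lie_def, Ring.lie_def, neg_sub]
  rw [h5, neg_mul, mul_neg, h3]

end PeirceRel

theorem CornersCentral.symm (h : CornersCentral e f φ) : CornersCentral f e φ := ⟨h.2, h.1⟩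

end CornerConditions

section Assembling

variable {R A : Type*} [CommRing R] [Ring A] [Algebra R A] {e f : A}

theorem mul_eq_zero_of_peirceComp {g₁ g₂ g₃ g₄ x y : A} (hx : x ∈ peirceComp g₁ g₂)
    (hy : y ∈ peirceComp g₃ g₄) (h : g₂ * g₃ = 0) : x * y = 0 := by
  obtain ⟨x, rfl⟩ := hx
  obtain ⟨y, rfl⟩ := hy
  calc g₁ * x * g₂ * (g₃ * y * g₄) = g₁ * x * (g₂ * g₃) * y * g₄ := by simp only [mul_assoc]
    _ = 0 := by rw [h]; simp

namespace PeirceSetup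

theorem of_components (h : PeirceSetup e f) {P : A → A → Prop}
    (hl : ∀ x y z, P x z → P y z → P (x + y) z) (hr : ∀ x y z, P x y → P x z → P x (y + z))
    (hP : ∀ x y, (x ∈ peirceComp e e ∨ x ∈ peirceComp e f ∨ x ∈ peirceComp f e ∨
      x ∈ peirceComp f f) → (y ∈ peirceComp e e ∨ y ∈ peirceComp e f ∨ y ∈ peirceComp f e ∨
      y ∈ peirceComp f f) → P x y) (x y : A) : P x y := by
  have h1 : ∀ x y, (x ∈ peirceComp e e ∨ x ∈ peirceComp e f ∨ x ∈ peirceComp f e ∨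
      x ∈ peirceComp f f) → P x y := by
    intro x y hx
    rw [h.decomp y]
    exact hr _ _ _ (hr _ _ _ (hr _ _ _ (hP _ _ hx (.inl ⟨_, rfl⟩))
      (hP _ _ hx (.inr (.inl ⟨_, rfl⟩)))) (hP _ _ hx (.inr (.inr (.inl ⟨_, rfl⟩)))))
      (hP _ _ hx (.inr (.inr (.inr ⟨_, rfl⟩))))
  rw [h.decomp x]
  exact hl _ _ _ (hl _ _ _ (hl _ _ _ (h1 _ _ (.inl ⟨_, rfl⟩))
    (h1 _ _ (.inr (.inl ⟨_, rfl⟩)))) (h1 _ _ (.inr (.inr (.inl ⟨_, rfl⟩)))))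
    (h1 _ _ (.inr (.inr (.inr ⟨_, rfl⟩))))

theorem exists_central_lift (h : PeirceSetup e f) (L : A →ₗ[R] A)
    (hL : ∀ x, L x ∈ cornerOfCenter f) :
    ∃ γ : A →ₗ[R] A, ∀ x, γ x ∈ Set.center A ∧ f * γ x * f = L x := by
  choose g hg hgL using hL
  simp only at hgL
  have huniq : ∀ z ∈ Set.center A, ∀ w ∈ Set.center A, f * z * f = f * w * f → z = w := by
    intro z hz w hw hzw
    rw [← sub_eq_zero]
    refine h.center_eq_zero ?_ (by rw [mul_sub, sub_mul, hzw, sub_self])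
    rw [sub_eq_add_neg]
    exact Set.add_mem_center hz (Set.neg_mem_center hw)
  refine ⟨{ toFun := g, map_add' := fun x y => ?_, map_smul' := fun r x => ?_ },
    fun x => ⟨hg x, hgL x⟩⟩
  · refine huniq _ (hg _) _ (Set.add_mem_center (hg _) (hg _)) ?_
    rw [hgL, mul_add, add_mul, hgL, hgL, map_add]
  · refine huniq _ (hg _) _ (Set.smul_mem_center r (hg _)) ?_
    rw [hgL, RingHom.id_apply, mul_smul_comm, smul_mul_assoc, hgL, map_smul]

end PeirceSetup

/-- Half of the conditions making `d` a derivation that preserves the Peirce components. -/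
structure PeirceDer (e f : A) (d : A →ₗ[R] A) : Prop where
  map_ee : ∀ a ∈ peirceComp e e, d a ∈ peirceComp e e
  map_ef : ∀ m ∈ peirceComp e f, d m ∈ peirceComp e f
  left_mul : ∀ a ∈ peirceComp e e, ∀ m ∈ peirceComp e f, d (a * m) = d a * m + a * d m
  mul_right : ∀ m ∈ peirceComp e f, ∀ b ∈ peirceComp f f, d (m * b) = d m * b + m * d b

/-- Half of the conditions making `δ` a singular Jordan derivation. -/
structure PeirceAnti (e f : A) (δ : A →ₗ[R] A) : Prop where
  map_ee : ∀ a ∈ peirceComp e e, δ a = 0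
  map_ef : ∀ m ∈ peirceComp e f, δ m ∈ peirceComp f e
  left_mul : ∀ a ∈ peirceComp e e, ∀ m ∈ peirceComp e f, δ (a * m) = δ m * a
  mul_right : ∀ m ∈ peirceComp e f, ∀ b ∈ peirceComp f f, δ (m * b) = b * δ m
  skew : ∀ m ∈ peirceComp e f, ∀ m' ∈ peirceComp e f, m' * δ m + m * δ m' = 0
  skew' : ∀ m ∈ peirceComp e f, ∀ m' ∈ peirceComp e f, δ m * m' + δ m' * m = 0

theorem PeirceDer.map_mul {d : A →ₗ[R] A} (hd : PeirceDer e f d) (hd' : PeirceDer f e d)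
    (h : PeirceSetup e f) {a a' : A} (ha : a ∈ peirceComp e e) (ha' : a' ∈ peirceComp e e) :
    d (a * a') = d a * a' + a * d a' := by
  rw [← sub_eq_zero]
  refine h.eq_zero_of_mul (sub_mem_peirceComp (hd.map_ee _ (mul_mem_peirceComp ha ha'))
    (add_mem_peirceComp (mul_mem_peirceComp (hd.map_ee _ ha) ha')
      (mul_mem_peirceComp ha (hd.map_ee _ ha')))) ?_ ?_
  · intro m hm
    have h1 := hd.left_mul _ (mul_mem_peirceComp ha ha') m hm
    have h2 := hd.left_mul a ha _ (mul_mem_peirceComp ha' hm)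
    rw [hd.left_mul a' ha' m hm, ← mul_assoc, h1] at h2
    linear_combination (norm := noncomm_ring) h2
  · intro t ht
    have h1 := hd'.mul_right t ht _ (mul_mem_peirceComp ha ha')
    have h2 := hd'.mul_right _ (mul_mem_peirceComp ht ha) a' ha'
    rw [hd'.mul_right t ht a ha, mul_assoc t a a', h1] at h2
    linear_combination (norm := noncomm_ring) h2

theorem PeirceDer.isDerivationMap {d : A →ₗ[R] A} (hd : PeirceDer e f d) (hd' : PeirceDer f e d)
    (h : PeirceSetup e f)
    (h1 : ∀ m ∈ peirceComp e f, ∀ t ∈ peirceComp f e, d (m * t) = d m * t + m * d t)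
    (h2 : ∀ m ∈ peirceComp e f, ∀ t ∈ peirceComp f e, d (t * m) = d t * m + t * d m) :
    IsDerivationMap d := by
  have h0 : ∀ g₁ g₂ g₃ g₄ x y : A, x ∈ peirceComp g₁ g₂ → y ∈ peirceComp g₃ g₄ →
      d x ∈ peirceComp g₁ g₂ → d y ∈ peirceComp g₃ g₄ → g₂ * g₃ = 0 →
      d (x * y) = d x * y + x * d y := fun g₁ g₂ g₃ g₄ x y hx hy hdx hdy hg => by
    rw [mul_eq_zero_of_peirceComp hx hy hg, mul_eq_zero_of_peirceComp hdx hy hg,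
      mul_eq_zero_of_peirceComp hx hdy hg, map_zero, add_zero]
  refine h.of_components ?_ ?_ ?_
  · intro x y z hx hy
    rw [add_mul, map_add, hx, hy, map_add, add_mul, add_mul]
    abel
  · intro x y z hy hz
    rw [mul_add, map_add, hy, hz, map_add, mul_add, mul_add]
    abel
  · rintro x y (hx | hx | hx | hx) (hy | hy | hy | hy)
    · exact hd.map_mul hd' h hx hy
    · exact hd.left_mul x hx y hy
    · exact h0 _ _ _ _ x y hx hy (hd.map_ee x hx) (hd'.map_ef y hy) h.ef
    · exact h0 _ _ _ _ x y hx hy (hd.map_ee x hx) (hd'.map_ee y hy) h.ef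
    · exact h0 _ _ _ _ x y hx hy (hd.map_ef x hx) (hd.map_ee y hy) h.fe
    · exact h0 _ _ _ _ x y hx hy (hd.map_ef x hx) (hd.map_ef y hy) h.fe
    · exact h1 x hx y hy
    · exact hd.mul_right x hx y hy
    · exact hd'.mul_right x hx y hy
    · exact h2 y hy x hx
    · exact h0 _ _ _ _ x y hx hy (hd'.map_ef x hx) (hd'.map_ef y hy) h.ef
    · exact h0 _ _ _ _ x y hx hy (hd'.map_ef x hx) (hd'.map_ee y hy) h.ef
    · exact h0 _ _ _ _ x y hx hy (hd'.map_ee x hx) (hd.map_ee y hy) h.fe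
    · exact h0 _ _ _ _ x y hx hy (hd'.map_ee x hx) (hd.map_ef y hy) h.fe
    · exact hd'.left_mul x hx y hy
    · exact hd'.map_mul hd h.symm hx hy

namespace PeirceAnti

variable {δ : A →ₗ[R] A}

theorem isSingularJordanDerivation (hδ : PeirceAnti e f δ) (hδ' : PeirceAnti f e δ)
    (h : PeirceSetup e f) : IsSingularJordanDerivation e f δ := by
  refine ⟨?_, hδ.map_ee, hδ'.map_ee, hδ.map_ef, hδ'.map_ef⟩
  have hz : ∀ {g₁ g₂ g₃ g₄ x y : A}, x ∈ peirceComp g₁ g₂ → y ∈ peirceComp g₃ g₄ →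
    g₂ * g₃ = 0 → x * y = 0 := fun hx hy => mul_eq_zero_of_peirceComp hx hy
  have hswap : ∀ x y : A, δ (x * y + y * x) = δ x * y + y * δ x + (x * δ y + δ y * x) →
      δ (y * x + x * y) = δ y * x + x * δ y + (y * δ x + δ x * y) := by
    intro x y hxy
    rw [add_comm (y * x), hxy]
    abel
  have haa : ∀ x y, δ x = 0 → δ y = 0 → δ (x * y) = 0 → δ (y * x) = 0 →
      δ (x * y + y * x) = δ x * y + y * δ x + (x * δ y + δ y * x) := by
    intro x y hx hy hxy hyx
    simp [hx, hy, hxy, hyx]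
  have ham : ∀ a ∈ peirceComp e e, ∀ m ∈ peirceComp e f,
      δ (a * m + m * a) = δ a * m + m * δ a + (a * δ m + δ m * a) := by
    intro a ha m hm
    rw [hz hm ha h.fe, hδ.map_ee a ha, hz ha (hδ.map_ef m hm) h.ef, add_zero,
      hδ.left_mul a ha m hm]
    simp
  have hbt : ∀ a ∈ peirceComp f f, ∀ m ∈ peirceComp f e,
      δ (a * m + m * a) = δ a * m + m * δ a + (a * δ m + δ m * a) := by
    intro a ha m hm
    rw [hz hm ha h.ef, hδ'.map_ee a ha, hz ha (hδ'.map_ef m hm) h.fe, add_zero,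
      hδ'.left_mul a ha m hm]
    simp
  have hmb : ∀ m ∈ peirceComp e f, ∀ b ∈ peirceComp f f,
      δ (m * b + b * m) = δ m * b + b * δ m + (m * δ b + δ b * m) := by
    intro m hm b hb
    rw [hz hb hm h.fe, hδ'.map_ee b hb, hz (hδ.map_ef m hm) hb h.ef, add_zero,
      hδ.mul_right m hm b hb]
    simp
  have hta : ∀ m ∈ peirceComp f e, ∀ b ∈ peirceComp e e,
      δ (m * b + b * m) = δ m * b + b * δ m + (m * δ b + δ b * m) := by
    intro m hm b hb
    rw [hz hb hm h.ef, hδ.map_ee b hb, hz (hδ'.map_ef m hm) hb h.fe, add_zero,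
      hδ'.mul_right m hm b hb]
    simp
  have hmt : ∀ m ∈ peirceComp e f, ∀ t ∈ peirceComp f e,
      δ (m * t + t * m) = δ m * t + t * δ m + (m * δ t + δ t * m) := by
    intro m hm t ht
    rw [hz (hδ.map_ef m hm) ht h.ef, hz ht (hδ.map_ef m hm) h.ef, hz hm (hδ'.map_ef t ht) h.fe,
      hz (hδ'.map_ef t ht) hm h.fe, map_add, hδ.map_ee _ (mul_mem_peirceComp hm ht),
      hδ'.map_ee _ (mul_mem_peirceComp ht hm)]
    simp
  refine h.of_components ?_ ?_ ?_
  · intro x y z hx hy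
    have h1 : (x + y) * z + z * (x + y) = (x * z + z * x) + (y * z + z * y) := by noncomm_ring
    rw [h1, map_add, hx, hy, map_add]
    noncomm_ring
  · intro x y z hy hz
    have h1 : x * (y + z) + (y + z) * x = (x * y + y * x) + (x * z + z * x) := by noncomm_ring
    rw [h1, map_add, hy, hz, map_add]
    noncomm_ring
  · rintro x y (hx | hx | hx | hx) (hy | hy | hy | hy)
    · exact haa x y (hδ.map_ee x hx) (hδ.map_ee y hy) (hδ.map_ee _ (mul_mem_peirceComp hx hy))
        (hδ.map_ee _ (mul_mem_peirceComp hy hx))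
    · exact ham x hx y hy
    · exact hswap _ _ (hta y hy x hx)
    · exact haa x y (hδ.map_ee x hx) (hδ'.map_ee y hy) (by rw [hz hx hy h.ef, map_zero])
        (by rw [hz hy hx h.fe, map_zero])
    · exact hswap _ _ (ham y hy x hx)
    · rw [hz hx hy h.fe, hz hy hx h.fe, add_zero, map_zero]
      have h1 := hδ.skew x hx y hy
      have h2 := hδ.skew' x hx y hy
      linear_combination (norm := abel) -h1 - h2
    · exact hmt x hx y hy
    · exact hmb x hx y hy
    · exact hta x hx y hy
    · exact hswap _ _ (hmt y hy x hx)
    · rw [hz hx hy h.ef, hz hy hx h.ef, add_zero, map_zero]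
      have h1 := hδ'.skew x hx y hy
      have h2 := hδ'.skew' x hx y hy
      linear_combination (norm := abel) -h1 - h2
    · exact hswap _ _ (hbt y hy x hx)
    · exact haa x y (hδ'.map_ee x hx) (hδ.map_ee y hy) (by rw [hz hx hy h.fe, map_zero])
        (by rw [hz hy hx h.ef, map_zero])
    · exact hswap _ _ (hmb y hy x hx)
    · exact hbt x hx y hy
    · exact haa x y (hδ'.map_ee x hx) (hδ'.map_ee y hy) (hδ'.map_ee _ (mul_mem_peirceComp hx hy))
        (hδ'.map_ee _ (mul_mem_peirceComp hy hx))

theorem isAntiderivationMap (hδ : PeirceAnti e f δ) (hδ' : PeirceAnti f e δ)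
    (h : PeirceSetup e f)
    (h1 : ∀ m ∈ peirceComp e f, ∀ m' ∈ peirceComp e f, m * δ m' = 0 ∧ δ m * m' = 0)
    (h2 : ∀ t ∈ peirceComp f e, ∀ t' ∈ peirceComp f e, t * δ t' = 0 ∧ δ t * t' = 0) :
    IsAntiderivationMap δ := by
  have hz : ∀ {g₁ g₂ g₃ g₄ x y : A}, x ∈ peirceComp g₁ g₂ → y ∈ peirceComp g₃ g₄ →
    g₂ * g₃ = 0 → x * y = 0 := fun hx hy => mul_eq_zero_of_peirceComp hx hy
  refine h.of_components ?_ ?_ ?_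
  · intro x y z hx hy
    rw [add_mul, map_add, hx, hy, map_add, mul_add, mul_add]
    abel
  · intro x y z hy hz
    rw [mul_add, map_add, hy, hz, map_add, add_mul, add_mul]
    abel
  · rintro x y (hx | hx | hx | hx) (hy | hy | hy | hy)
    · simp [hδ.map_ee x hx, hδ.map_ee y hy, hδ.map_ee _ (mul_mem_peirceComp hx hy)]
    · simp [hδ.map_ee x hx, hδ.left_mul x hx y hy]
    · simp [hδ.map_ee x hx, hz hx hy h.ef, hz (hδ'.map_ef y hy) hx h.fe]
    · simp [hδ.map_ee x hx, hδ'.map_ee y hy, hz hx hy h.ef]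
    · simp [hδ.map_ee y hy, hz hx hy h.fe, hz hy (hδ.map_ef x hx) h.ef]
    · simp [hz hx hy h.fe, (h1 y hy x hx).1, (h1 y hy x hx).2]
    · simp [hδ.map_ee _ (mul_mem_peirceComp hx hy), hz hy (hδ.map_ef x hx) h.ef,
        hz (hδ'.map_ef y hy) hx h.fe]
    · simp [hδ'.map_ee y hy, hδ.mul_right x hx y hy]
    · simp [hδ.map_ee y hy, hδ'.mul_right x hx y hy]
    · simp [hδ'.map_ee _ (mul_mem_peirceComp hx hy), hz hy (hδ'.map_ef x hx) h.fe,
        hz (hδ.map_ef y hy) hx h.ef]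
    · simp [hz hx hy h.ef, (h2 y hy x hx).1, (h2 y hy x hx).2]
    · simp [hδ'.map_ee y hy, hz hx hy h.ef, hz hy (hδ'.map_ef x hx) h.fe]
    · simp [hδ'.map_ee x hx, hδ.map_ee y hy, hz hx hy h.fe]
    · simp [hδ'.map_ee x hx, hz hx hy h.fe, hz (hδ.map_ef y hy) hx h.ef]
    · simp [hδ'.map_ee x hx, hδ'.left_mul x hx y hy]
    · simp [hδ'.map_ee x hx, hδ'.map_ee y hy, hδ'.map_ee _ (mul_mem_peirceComp hx hy)]

theorem mul_add_mul_mem_center (hδ : PeirceAnti e f δ) (h : PeirceSetup e f) {m m' : A}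
    (hm : m ∈ peirceComp e f) (hm' : m' ∈ peirceComp e f) :
    m * δ m' + δ m * m' ∈ Set.center A := by
  refine h.mem_center_of (mul_mem_peirceComp hm (hδ.map_ef _ hm'))
    (mul_mem_peirceComp (hδ.map_ef _ hm) hm') (fun x hx => ?_) fun t ht => ?_
  · have h1 := congrArg (· * x) (hδ.skew m hm m' hm')
    have h2 := congrArg (m' * ·) (hδ.skew' m hm x hx)
    have h3 := congrArg (· * m) (hδ.skew m' hm' x hx)
    have h4 := congrArg (x * ·) (hδ.skew' m hm m' hm')
    simp only [zero_mul, mul_zero] at h1 h2 h3 h4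
    linear_combination (norm := noncomm_ring) h1 - h2 + h3 - h4
  · have h1 := hδ.mul_right m' hm' (t * m) (mul_mem_peirceComp ht hm)
    have h2 := hδ.left_mul (m' * t) (mul_mem_peirceComp hm' ht) m hm
    rw [mul_assoc, h1] at h2
    simp only [mul_assoc] at h2 ⊢
    exact h2

end PeirceAnti

theorem NoNonzeroCentralIdeal.eq_zero (hn : NoNonzeroCentralIdeal (corner R e)) {S : Set A}
    (hS : ∀ s ∈ S, s ∈ peirceComp e e)
    (hcomm : ∀ s ∈ S, ∀ a ∈ peirceComp e e, a * s = s * a)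
    (hmul : ∀ s ∈ S, ∀ a ∈ peirceComp e e, a * s ∈ S) : ∀ s ∈ S, s = 0 := by
  have hcomm' : ∀ s ∈ AddSubgroup.closure S, ∀ a ∈ peirceComp e e, a * s = s * a := by
    intro s hs a ha
    induction hs using AddSubgroup.closure_induction with
    | mem s hs => exact hcomm s hs a ha
    | zero => simp
    | add x y _ _ hx hy => rw [mul_add, add_mul, hx, hy]
    | neg x _ hx => rw [mul_neg, neg_mul, hx]
  have hmul' : ∀ s ∈ AddSubgroup.closure S, ∀ a ∈ peirceComp e e,
      a * s ∈ AddSubgroup.closure S := by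
    intro s hs a ha
    induction hs using AddSubgroup.closure_induction with
    | mem s hs => exact AddSubgroup.subset_closure (hmul s hs a ha)
    | zero => rw [mul_zero]; exact zero_mem _
    | add x y _ _ hx hy => rw [mul_add]; exact add_mem hx hy
    | neg x _ hx => rw [mul_neg]; exact neg_mem hx
  let I : TwoSidedIdeal (corner R e) := TwoSidedIdeal.mk' {x | x.1 ∈ AddSubgroup.closure S}
    (zero_mem (AddSubgroup.closure S))
    (fun {x y} hx hy => (add_mem hx hy : x.1 + y.1 ∈ AddSubgroup.closure S)) 
    (fun {x} hx => (neg_mem hx : -x.1 ∈ AddSubgroup.closure S))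
    (fun {x y} hy => hmul' y.1 hy x.1 x.2)
    (fun {x y} hx => by
      have := hmul' x.1 hx y.1 y.2
      rw [hcomm' x.1 hx y.1 y.2] at this
      exact this)
  have hI : ∀ x, x ∈ I ↔ x.1 ∈ AddSubgroup.closure S := fun x => TwoSidedIdeal.mem_mk' ..
  have h0 := hn I fun x hx => Semigroup.mem_center_iff.2 fun y =>
    Subtype.ext (hcomm' x.1 ((hI x).1 hx) y.1 y.2)
  intro s hs
  have h1 : (⟨s, hS s hs⟩ : corner R e) ∈ I := (hI _).2 (AddSubgroup.subset_closure hs)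
  rw [h0, TwoSidedIdeal.mem_bot] at h1
  exact congrArg Subtype.val h1

end Assembling

section Defect

variable {R A : Type*} [CommRing R] [Ring A] [Algebra R A] {e f : A} {d : A →ₗ[R] A}

/-- The defect of `d` from satisfying the Leibniz rule at `x`, `y`. -/
def leibnizDefect (d : A →ₗ[R] A) (x y : A) : A := d (x * y) - d x * y - x * d y

namespace PeirceDer

theorem leibnizDefect_mem (hd : PeirceDer e f d) (hd' : PeirceDer f e d) {m t : A}
    (hm : m ∈ peirceComp e f) (ht : t ∈ peirceComp f e) :
    leibnizDefect d m t ∈ peirceComp e e :=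
  sub_mem_peirceComp (sub_mem_peirceComp (hd.map_ee _ (mul_mem_peirceComp hm ht))
    (mul_mem_peirceComp (hd.map_ef m hm) ht)) (mul_mem_peirceComp hm (hd'.map_ef t ht))

theorem leibnizDefect_mul (hd : PeirceDer e f d) {m t m' : A} (hm : m ∈ peirceComp e f)
    (ht : t ∈ peirceComp f e) (hm' : m' ∈ peirceComp e f) :
    leibnizDefect d m t * m' = m * leibnizDefect d t m' := by
  have h1 := hd.left_mul (m * t) (mul_mem_peirceComp hm ht) m' hm'
  have h2 := hd.mul_right m hm (t * m') (mul_mem_peirceComp ht hm')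
  rw [mul_assoc, h2] at h1
  simp only [leibnizDefect]
  linear_combination (norm := noncomm_ring) -h1

theorem mul_leibnizDefect (hd : PeirceDer e f d) (hd' : PeirceDer f e d) (h : PeirceSetup e f)
    {a m t : A} (ha : a ∈ peirceComp e e) (hm : m ∈ peirceComp e f) (ht : t ∈ peirceComp f e) :
    a * leibnizDefect d m t = leibnizDefect d (a * m) t := by
  have h1 := hd.map_mul hd' h ha (mul_mem_peirceComp hm ht)
  simp only [leibnizDefect, hd.left_mul a ha m hm, mul_assoc, h1]
  noncomm_ring

end PeirceDer

/-- `d` is a derivation up to Leibniz defects on `eAf × fAe` and `fAe × eAf` with central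
differences. -/
structure PeirceAlmostDer (e f : A) (d : A →ₗ[R] A) : Prop where
  setup : PeirceSetup e f
  der : PeirceDer e f d
  der' : PeirceDer f e d
  sub_mem : ∀ m ∈ peirceComp e f, ∀ t ∈ peirceComp f e,
    leibnizDefect d m t - leibnizDefect d t m ∈ Set.center A

namespace PeirceAlmostDer

theorem symm (H : PeirceAlmostDer e f d) : PeirceAlmostDer f e d :=
  ⟨H.setup.symm, H.der', H.der, fun t ht m hm => by
    rw [← neg_sub]; exact Set.neg_mem_center (H.sub_mem m hm t ht)⟩

theorem mem_cornerOfCenter (H : PeirceAlmostDer e f d) {m t : A} (hm : m ∈ peirceComp e f)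
    (ht : t ∈ peirceComp f e) : leibnizDefect d m t ∈ cornerOfCenter e := by
  refine ⟨_, H.sub_mem m hm t ht, ?_⟩
  obtain ⟨x, hx⟩ := H.der.leibnizDefect_mem H.der' hm ht
  obtain ⟨y, hy⟩ := H.der'.leibnizDefect_mem H.der ht hm
  rw [← hx, ← hy]
  simp only [H.setup.rules, sub_zero]

theorem leibnizDefect_mul_comm (H : PeirceAlmostDer e f d) {m t m' : A}
    (hm : m ∈ peirceComp e f) (ht : t ∈ peirceComp f e) (hm' : m' ∈ peirceComp e f) :
    leibnizDefect d m t * m' = -(leibnizDefect d m' t * m) := by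
  have h1 := PeirceSetup.center_comm (H.sub_mem m' hm' t ht) m
  rw [sub_mul, mul_sub,
    mul_eq_zero_of_peirceComp (H.der'.leibnizDefect_mem H.der ht hm') hm H.setup.fe,
    mul_eq_zero_of_peirceComp hm (H.der.leibnizDefect_mem H.der' hm' ht) H.setup.fe,
    sub_zero, zero_sub, ← H.der.leibnizDefect_mul hm ht hm'] at h1
  rw [h1, neg_neg]

theorem mul_leibnizDefect_comm (H : PeirceAlmostDer e f d) {m t t' : A}
    (hm : m ∈ peirceComp e f) (ht : t ∈ peirceComp f e) (ht' : t' ∈ peirceComp f e) :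
    t' * leibnizDefect d m t = -(t * leibnizDefect d m t') := by
  have h1 := PeirceSetup.center_comm (H.sub_mem m hm t ht) t'
  rw [sub_mul, mul_sub,
    mul_eq_zero_of_peirceComp (H.der.leibnizDefect_mem H.der' hm ht) ht' H.setup.ef,
    mul_eq_zero_of_peirceComp ht' (H.der'.leibnizDefect_mem H.der ht hm) H.setup.ef,
    sub_zero, zero_sub, H.der'.leibnizDefect_mul ht hm ht'] at h1
  exact h1.symm

theorem leibnizDefect_symm_eq_zero (H : PeirceAlmostDer e f d) {m t : A}
    (hm : m ∈ peirceComp e f) (ht : t ∈ peirceComp f e) (h0 : leibnizDefect d m t = 0) :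
    leibnizDefect d t m = 0 := by
  have h1 := H.sub_mem m hm t ht
  rw [h0, zero_sub] at h1
  have h2 := Set.neg_mem_center h1
  rw [neg_neg] at h2
  exact H.setup.symm.center_eq_zero_of_mem h2 (H.der'.leibnizDefect_mem H.der ht hm)

theorem isDerivationMap (H : PeirceAlmostDer e f d)
    (h0 : ∀ m ∈ peirceComp e f, ∀ t ∈ peirceComp f e, leibnizDefect d m t = 0) :
    IsDerivationMap d := by
  refine H.der.isDerivationMap H.der' H.setup (fun m hm t ht => ?_) fun m hm t ht => ?_
  · have := h0 m hm t ht
    rwa [leibnizDefect, sub_sub, sub_eq_zero] at this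
  · have := H.leibnizDefect_symm_eq_zero hm ht (h0 m hm t ht)
    rwa [leibnizDefect, sub_sub, sub_eq_zero] at this

theorem isDerivationMap_of_noNonzeroCentralIdeal (H : PeirceAlmostDer e f d)
    (hn : NoNonzeroCentralIdeal (corner R e)) : IsDerivationMap d := by
  refine H.isDerivationMap fun m hm t ht => ?_
  refine hn.eq_zero (S := {x | ∃ m ∈ peirceComp e f, ∃ t ∈ peirceComp f e,
    x = leibnizDefect d m t}) ?_ ?_ ?_ _ ⟨m, hm, t, ht, rfl⟩
  · rintro _ ⟨m, hm, t, ht, rfl⟩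
    exact H.der.leibnizDefect_mem H.der' hm ht
  · rintro _ ⟨m, hm, t, ht, rfl⟩ a ha
    exact (H.setup.symm.commute_of_mem_cornerOfCenter ha (H.mem_cornerOfCenter hm ht)).symm
  · rintro _ ⟨m, hm, t, ht, rfl⟩ a ha
    exact ⟨a * m, mul_mem_peirceComp ha hm, t, ht,
      H.der.mul_leibnizDefect H.der' H.setup ha hm ht⟩

theorem isDerivationMap_of_orthogonal (H : PeirceAlmostDer e f d) (ho : PeirceOrthogonal e f) :
    IsDerivationMap d := by
  refine H.isDerivationMap fun m hm t ht => ?_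
  rw [leibnizDefect, (ho m hm t ht).1, (ho _ (H.der.map_ef m hm) t ht).1,
    (ho m hm _ (H.der'.map_ef t ht)).1]
  simp

theorem isDerivationMap_of_right (H : PeirceAlmostDer e f d) (h2 : IsTorsionFreeBy A 2) {m₀ : A}
    (hm₀ : m₀ ∈ peirceComp e f)
    (hc : ∀ a ∈ cornerOfCenter e, a * m₀ = 0 → a ∈ Set.center A) : IsDerivationMap d := by
  have key : ∀ m ∈ peirceComp e f, ∀ t ∈ peirceComp f e, leibnizDefect d m t * m₀ = 0 →
      leibnizDefect d m t = 0 := fun m hm t ht h0 =>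
    H.setup.center_eq_zero_of_mem (hc _ (H.mem_cornerOfCenter hm ht) h0)
      (H.der.leibnizDefect_mem H.der' hm ht)
  have h0 : ∀ t ∈ peirceComp f e, leibnizDefect d m₀ t = 0 := fun t ht => by
    refine key _ hm₀ _ ht (h2 _ ?_)
    rw [two_smul, ← eq_neg_iff_add_eq_zero]
    exact H.leibnizDefect_mul_comm hm₀ ht hm₀
  refine H.isDerivationMap fun m hm t ht => key _ hm _ ht ?_
  rw [H.leibnizDefect_mul_comm hm ht hm₀, h0 t ht, zero_mul, neg_zero]

theorem isDerivationMap_of_left (H : PeirceAlmostDer e f d) (h2 : IsTorsionFreeBy A 2) {t₀ : A}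
    (ht₀ : t₀ ∈ peirceComp f e)
    (hc : ∀ a ∈ cornerOfCenter e, t₀ * a = 0 → a ∈ Set.center A) : IsDerivationMap d := by
  have key : ∀ m ∈ peirceComp e f, ∀ t ∈ peirceComp f e, t₀ * leibnizDefect d m t = 0 →
      leibnizDefect d m t = 0 := fun m hm t ht h0 =>
    H.setup.center_eq_zero_of_mem (hc _ (H.mem_cornerOfCenter hm ht) h0)
      (H.der.leibnizDefect_mem H.der' hm ht)
  have h0 : ∀ m ∈ peirceComp e f, leibnizDefect d m t₀ = 0 := fun m hm => by
    refine key _ hm _ ht₀ (h2 _ ?_)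
    rw [two_smul, ← eq_neg_iff_add_eq_zero]
    exact H.mul_leibnizDefect_comm hm ht₀ ht₀
  refine H.isDerivationMap fun m hm t ht => key _ hm _ ht ?_
  rw [H.mul_leibnizDefect_comm hm ht ht₀, h0 m hm, mul_zero, neg_zero]

end PeirceAlmostDer

namespace PeirceAnti

variable {δ : A →ₗ[R] A}

theorem mul_eq_zero_iff (hδ : PeirceAnti e f δ) (h : PeirceSetup e f) {m m' : A}
    (hm : m ∈ peirceComp e f) (hm' : m' ∈ peirceComp e f) : m * δ m' = 0 ↔ δ m * m' = 0 := by
  have h1 := hδ.mul_add_mul_mem_center h hm hm'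
  constructor <;> intro h0
  · rw [h0, zero_add] at h1
    exact h.symm.center_eq_zero_of_mem h1 (mul_mem_peirceComp (hδ.map_ef m hm) hm')
  · rw [h0, add_zero] at h1
    exact h.center_eq_zero_of_mem h1 (mul_mem_peirceComp hm (hδ.map_ef m' hm'))

theorem mul_mem_cornerOfCenter (hδ : PeirceAnti e f δ) (h : PeirceSetup e f) {m m' : A}
    (hm : m ∈ peirceComp e f) (hm' : m' ∈ peirceComp e f) :
    m * δ m' ∈ cornerOfCenter e ∧ δ m * m' ∈ cornerOfCenter f := by
  obtain ⟨x, hx⟩ := mul_mem_peirceComp hm (hδ.map_ef m' hm')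
  obtain ⟨y, hy⟩ := mul_mem_peirceComp (hδ.map_ef m hm) hm'
  constructor <;> refine ⟨_, hδ.mul_add_mul_mem_center h hm hm', ?_⟩ <;> rw [← hx, ← hy] <;>
    simp only [h.rules, zero_add, add_zero]

theorem mul_eq_zero_of_left (hδ : PeirceAnti e f δ) (h : PeirceSetup e f)
    (hn : NoNonzeroCentralIdeal (corner R e)) :
    ∀ m ∈ peirceComp e f, ∀ m' ∈ peirceComp e f, m * δ m' = 0 ∧ δ m * m' = 0 := by
  intro m hm m' hm'
  rw [← hδ.mul_eq_zero_iff h hm hm', and_self]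
  refine hn.eq_zero (S := {x | ∃ m ∈ peirceComp e f, ∃ m' ∈ peirceComp e f, x = m * δ m'})
    ?_ ?_ ?_ _ ⟨m, hm, m', hm', rfl⟩
  · rintro _ ⟨m, hm, m', hm', rfl⟩
    exact mul_mem_peirceComp hm (hδ.map_ef m' hm')
  · rintro _ ⟨m, hm, m', hm', rfl⟩ a ha
    exact (h.symm.commute_of_mem_cornerOfCenter ha (hδ.mul_mem_cornerOfCenter h hm hm').1).symm
  · rintro _ ⟨m, hm, m', hm', rfl⟩ a ha
    exact ⟨a * m, mul_mem_peirceComp ha hm, m', hm', (mul_assoc _ _ _).symm⟩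

theorem mul_eq_zero_of_right (hδ : PeirceAnti e f δ) (h : PeirceSetup e f)
    (hn : NoNonzeroCentralIdeal (corner R f)) :
    ∀ m ∈ peirceComp e f, ∀ m' ∈ peirceComp e f, m * δ m' = 0 ∧ δ m * m' = 0 := by
  intro m hm m' hm'
  rw [hδ.mul_eq_zero_iff h hm hm', and_self]
  refine hn.eq_zero (S := {x | ∃ m ∈ peirceComp e f, ∃ m' ∈ peirceComp e f, x = δ m * m'})
    ?_ ?_ ?_ _ ⟨m, hm, m', hm', rfl⟩
  · rintro _ ⟨m, hm, m', hm', rfl⟩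
    exact mul_mem_peirceComp (hδ.map_ef m hm) hm'
  · rintro _ ⟨m, hm, m', hm', rfl⟩ b hb
    exact (h.commute_of_mem_cornerOfCenter hb (hδ.mul_mem_cornerOfCenter h hm hm').2).symm
  · rintro _ ⟨m, hm, m', hm', rfl⟩ b hb
    exact ⟨m * b, mul_mem_peirceComp hm hb, m', hm', by rw [hδ.mul_right m hm b hb, mul_assoc]⟩

theorem isAntiderivationMap_of_noNonzeroCentralIdeal (hδ : PeirceAnti e f δ)
    (hδ' : PeirceAnti f e δ) (h : PeirceSetup e f)
    (hn : NoNonzeroCentralIdeal (corner R e) ∨ NoNonzeroCentralIdeal (corner R f)) :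
    IsAntiderivationMap δ := by
  rcases hn with hn | hn
  · exact hδ.isAntiderivationMap hδ' h (hδ.mul_eq_zero_of_left h hn)
      (hδ'.mul_eq_zero_of_right h.symm hn)
  · exact hδ.isAntiderivationMap hδ' h (hδ.mul_eq_zero_of_right h hn)
      (hδ'.mul_eq_zero_of_left h.symm hn)

theorem isAntiderivationMap_of_orthogonal (hδ : PeirceAnti e f δ)
    (hδ' : PeirceAnti f e δ) (h : PeirceSetup e f) (ho : PeirceOrthogonal e f) :
    IsAntiderivationMap δ :=
  hδ.isAntiderivationMap hδ' h
    (fun m hm m' hm' => ⟨(ho m hm _ (hδ.map_ef m' hm')).1, (ho m' hm' _ (hδ.map_ef m hm)).2⟩)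
    (fun t ht t' ht' => ⟨(ho _ (hδ'.map_ef t' ht') t ht).2, (ho _ (hδ'.map_ef t ht) t' ht').1⟩)

end PeirceAnti

end Defect

section Main

variable {R A : Type*} [CommRing R] [Ring A] [Algebra R A] {e f : A} {φ : A →ₗ[R] A} {n k : ℕ}

namespace PeirceRel

theorem peirceDer (hr : PeirceRel e f φ) (hr' : PeirceRel f e φ) (h : PeirceSetup e f)
    {d γ : A →ₗ[R] A} (hγ : ∀ x, γ x ∈ Set.center A)
    (ha : ∀ a ∈ peirceComp e e, f * γ a * f = f * φ a * f)
    (hb : ∀ b ∈ peirceComp f f, e * γ b * e = e * φ b * e)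
    (hda : ∀ a ∈ peirceComp e e, d a = φ a - γ a) (hdb : ∀ b ∈ peirceComp f f, d b = φ b - γ b)
    (hdm : ∀ m ∈ peirceComp e f, d m = e * φ m * f) : PeirceDer e f d := by
  have h1 : ∀ a ∈ peirceComp e e, d a = e * φ a * e - e * γ a * e := fun a haa => by
    have h2 := h.decomp (φ a)
    rw [(hr.diag a haa).1, (hr.diag a haa).2, add_zero, add_zero] at h2
    rw [hda a haa, h2, h.center_eq (hγ a), ha a haa]
    simp only [h.rules]
    abel
  have h2 : ∀ b ∈ peirceComp f f, d b = f * φ b * f - f * γ b * f := fun b hbb => by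
    have h2 := h.decomp (φ b)
    rw [(hr'.diag b hbb).1, (hr'.diag b hbb).2, add_zero, add_zero] at h2
    rw [hdb b hbb, h2, h.center_eq (hγ b), hb b hbb]
    simp only [h.rules]
    abel
  refine ⟨fun a haa => ?_, fun m hm => ?_, fun a haa m hm => ?_, fun m hm b hbb => ?_⟩
  · rw [h1 a haa]
    exact sub_mem_peirceComp ⟨_, rfl⟩ ⟨_, rfl⟩
  · rw [hdm m hm]
    exact ⟨_, rfl⟩
  · rw [hdm _ (mul_mem_peirceComp haa hm), hr.left_mul a haa m hm, h1 a haa, hdm m hm, sub_mul,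
      h.center_mul (hγ a) hm, ha a haa]
  · rw [hdm _ (mul_mem_peirceComp hm hbb), hr.mul_right m hm b hbb, h2 b hbb, hdm m hm, mul_sub,
      ← h.center_mul (hγ b) hm, hb b hbb, add_sub_assoc]

theorem peirceAnti (hr : PeirceRel e f φ) {δ : A →ₗ[R] A}
    (ha : ∀ a ∈ peirceComp e e, δ a = 0) (hm : ∀ m ∈ peirceComp e f, δ m = f * φ m * e) :
    PeirceAnti e f δ := by
  refine ⟨ha, fun m hmm => ?_, fun a haa m hmm => ?_, fun m hmm b hb => ?_, fun m h1 m' h2 => ?_,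
    fun m h1 m' h2 => ?_⟩
  · rw [hm m hmm]
    exact ⟨_, rfl⟩
  · rw [hm _ (mul_mem_peirceComp haa hmm), hr.left_mul' a haa m hmm, hm m hmm]
  · rw [hm _ (mul_mem_peirceComp hmm hb), hr.mul_right' m hmm b hb, hm m hmm]
  · rw [hm m h1, hm m' h2]
    exact (hr.skew m h1 m' h2).1
  · rw [hm m h1, hm m' h2]
    exact (hr.skew m h1 m' h2).2

/-- The linear map `x ↦ g * x * g'`. -/
def _root_.sandwich (R : Type*) {A : Type*} [CommRing R] [Ring A] [Algebra R A] (g g' : A) :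
    A →ₗ[R] A :=
  LinearMap.mulRight R g' ∘ₗ LinearMap.mulLeft R g

theorem _root_.sandwich_apply (g g' x : A) : sandwich R g g' x = g * x * g' := rfl

theorem exists_central_part (h : PeirceSetup e f) (hc : CornersCentral e f φ) :
    ∃ γ : A →ₗ[R] A, (∀ x, γ x ∈ Set.center A) ∧
      (∀ a ∈ peirceComp e e, f * γ a * f = f * φ a * f) ∧
      (∀ b ∈ peirceComp f f, e * γ b * e = e * φ b * e) ∧
      (∀ m ∈ peirceComp e f, γ m = 0) ∧ ∀ t ∈ peirceComp f e, γ t = 0 := by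
  obtain ⟨γ₁, h1⟩ := h.exists_central_lift (sandwich R f f ∘ₗ φ ∘ₗ sandwich R e e)
    fun x => hc.1 _ ⟨x, rfl⟩
  obtain ⟨γ₂, h2⟩ := h.symm.exists_central_lift (sandwich R e e ∘ₗ φ ∘ₗ sandwich R f f)
    fun x => hc.2 _ ⟨x, rfl⟩
  simp only [LinearMap.comp_apply, sandwich_apply] at h1 h2
  have h3 : ∀ x, e * x * e = 0 → γ₁ x = 0 := fun x hx => by
    refine h.center_eq_zero (h1 x).1 ?_
    rw [(h1 x).2, hx, map_zero, mul_zero, zero_mul]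
  have h4 : ∀ x, f * x * f = 0 → γ₂ x = 0 := fun x hx => by
    refine h.symm.center_eq_zero (h2 x).1 ?_
    rw [(h2 x).2, hx, map_zero, mul_zero, zero_mul]
  refine ⟨γ₁ + γ₂, fun x => Set.add_mem_center (h1 x).1 (h2 x).1, ?_, ?_, ?_, ?_⟩
  · rintro _ ⟨x, rfl⟩
    rw [LinearMap.add_apply, h4 _ (by simp only [h.rules]), add_zero, (h1 _).2]
    simp only [h.rules]
  · rintro _ ⟨x, rfl⟩
    rw [LinearMap.add_apply, h3 _ (by simp only [h.rules]), zero_add, (h2 _).2]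
    simp only [h.rules]
  · rintro _ ⟨x, rfl⟩
    rw [LinearMap.add_apply, h3 _ (by simp only [h.rules]), h4 _ (by simp only [h.rules]), add_zero]
  · rintro _ ⟨x, rfl⟩
    rw [LinearMap.add_apply, h3 _ (by simp only [h.rules]), h4 _ (by simp only [h.rules]), add_zero]

theorem exists_decomposition (hr : PeirceRel e f φ) (hr' : PeirceRel f e φ)
    (h : PeirceSetup e f) (hc : CornersCentral e f φ) :
    ∃ d δ γ : A →ₗ[R] A, φ = d + δ + γ ∧ PeirceAlmostDer e f d ∧ PeirceAnti e f δ ∧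
      PeirceAnti f e δ ∧ (∀ x, γ x ∈ Set.center A) ∧
      (∀ x, δ x = f * φ (e * x * f) * e + e * φ (f * x * e) * f) ∧
      (∀ a ∈ peirceComp e e, f * γ a * f = f * φ a * f) ∧
      (∀ b ∈ peirceComp f f, e * γ b * e = e * φ b * e) ∧
      ∀ m ∈ peirceComp e f, ∀ t ∈ peirceComp f e,
        leibnizDefect d m t - leibnizDefect d t m = γ (t * m) - γ (m * t) := by
  obtain ⟨γ, hγ, ha, hb, hm, ht⟩ := exists_central_part h hc
  set δ : A →ₗ[R] A := sandwich R f e ∘ₗ φ ∘ₗ sandwich R e f + sandwich R e f ∘ₗ φ ∘ₗ sandwich R f e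
    with hδ
  have hδx : ∀ x, δ x = f * φ (e * x * f) * e + e * φ (f * x * e) * f := fun x => rfl
  have hδa : ∀ a ∈ peirceComp e e, δ a = 0 := by
    rintro _ ⟨x, rfl⟩
    simp only [hδx, h.rules, map_zero, add_zero]
  have hδb : ∀ a ∈ peirceComp f f, δ a = 0 := by
    rintro _ ⟨x, rfl⟩
    simp only [hδx, h.rules, map_zero, add_zero]
  have hδm : ∀ m ∈ peirceComp e f, δ m = f * φ m * e := by
    rintro _ ⟨x, rfl⟩
    simp only [hδx, h.rules, map_zero, add_zero]
  have hδt : ∀ m ∈ peirceComp f e, δ m = e * φ m * f := by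
    rintro _ ⟨x, rfl⟩
    simp only [hδx, h.rules, map_zero, zero_add]
  set d : A →ₗ[R] A := φ - δ - γ with hd
  have hda : ∀ a ∈ peirceComp e e, d a = φ a - γ a := fun a haa => by simp [hd, hδa a haa]
  have hdb : ∀ a ∈ peirceComp f f, d a = φ a - γ a := fun a haa => by simp [hd, hδb a haa]
  have hdm : ∀ m ∈ peirceComp e f, d m = e * φ m * f := fun m hmm => by
    have h1 := h.decomp (φ m)
    rw [(hr.off m hmm).1, (hr.off m hmm).2, add_zero, zero_add] at h1
    rw [hd, LinearMap.sub_apply, LinearMap.sub_apply, hδm m hmm, hm m hmm, sub_zero,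
      sub_eq_iff_eq_add]
    exact h1
  have hdt : ∀ m ∈ peirceComp f e, d m = f * φ m * e := fun m hmm => by
    have h1 := h.decomp (φ m)
    rw [(hr'.off m hmm).1, (hr'.off m hmm).2, add_zero, zero_add] at h1
    rw [hd, LinearMap.sub_apply, LinearMap.sub_apply, hδt m hmm, ht m hmm, sub_zero,
      sub_eq_iff_eq_add, add_comm]
    exact h1
  have hsub : ∀ m ∈ peirceComp e f, ∀ t ∈ peirceComp f e,
      leibnizDefect d m t - leibnizDefect d t m = γ (t * m) - γ (m * t) := fun m hmm t htt => by
    have h1 := hr.lie m hmm t htt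
    rw [← hdm m hmm, ← hdt t htt] at h1
    rw [leibnizDefect, leibnizDefect, hda _ (mul_mem_peirceComp hmm htt),
      hdb _ (mul_mem_peirceComp htt hmm)]
    linear_combination (norm := abel) h1
  refine ⟨d, δ, γ, by rw [hd]; abel, ⟨h, hr.peirceDer hr' h hγ ha hb hda hdb hdm,
    hr'.peirceDer hr h.symm hγ hb ha hdb hda hdt, fun m hmm t htt => ?_⟩, hr.peirceAnti hδa hδm,
    hr'.peirceAnti hδb hδt, hγ, hδx, ha, hb, hsub⟩
  rw [hsub m hmm t htt, sub_eq_add_neg]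
  exact Set.add_mem_center (hγ _) (Set.neg_mem_center (hγ _))

end PeirceRel

theorem PeirceAlmostDer.isDerivationMap_of_central {d γ : A →ₗ[R] A}
    (H : PeirceAlmostDer e f d) (hγ : ∀ x, γ x ∈ Set.center A)
    (ha : ∀ a ∈ peirceComp e e, f * γ a * f = f * φ a * f)
    (hb : ∀ b ∈ peirceComp f f, e * γ b * e = e * φ b * e)
    (hsub : ∀ m ∈ peirceComp e f, ∀ t ∈ peirceComp f e,
      leibnizDefect d m t - leibnizDefect d t m = γ (t * m) - γ (m * t))
    (hc : ∀ m ∈ peirceComp e f, ∀ t ∈ peirceComp f e,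
      e * φ (t * m) * e + f * φ (m * t) * f ∈ Set.center A) : IsDerivationMap d := by
  have h := H.setup
  refine H.isDerivationMap fun m hm t ht => ?_
  have hw := hc m hm t ht
  rw [← ha _ (mul_mem_peirceComp hm ht), ← hb _ (mul_mem_peirceComp ht hm)] at hw
  have h1 : e * γ (t * m) * e + f * γ (m * t) * f - γ (m * t) = 0 := by
    refine h.center_eq_zero ?_ (by simp only [h.rules, zero_add, sub_self])
    rw [sub_eq_add_neg]
    exact Set.add_mem_center hw (Set.neg_mem_center (hγ _))
  have h2 : e * γ (t * m) * e + f * γ (m * t) * f - γ (t * m) = 0 := by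
    refine h.symm.center_eq_zero ?_ (by simp only [h.rules, add_zero, sub_self])
    rw [sub_eq_add_neg]
    exact Set.add_mem_center hw (Set.neg_mem_center (hγ _))
  have h3 := hsub m hm t ht
  rw [(sub_eq_zero.1 h2).symm.trans (sub_eq_zero.1 h1), sub_self, sub_eq_zero] at h3
  obtain ⟨x, hx⟩ := H.der.leibnizDefect_mem H.der' hm ht
  obtain ⟨y, hy⟩ := H.der'.leibnizDefect_mem H.der ht hm
  have h4 : leibnizDefect d m t = e * leibnizDefect d m t * e := by
    rw [← hx]; simp only [h.rules]
  rw [h4, h3, ← hy]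
  simp only [h.rules]

/-- If `φ = d + δ + γ` is a Lie `n`-derivation with `d` a derivation, `δ` a Jordan derivation that
vanishes for even `n`, and `γ` central-valued, then `γ` vanishes on `(n-1)`-th commutators. -/
theorem isCentralVanishing_of_decomposition (hφ : IsLieNDerivation (k + 2) φ) {d δ γ : A →ₗ[R] A}
    (hsum : φ = d + δ + γ) (hd : IsDerivationMap d) (hδ : IsJordanDerivationMap δ)
    (hδ0 : Even k → δ = 0) (hγ : ∀ x, γ x ∈ Set.center A) : IsCentralVanishing (k + 2) γ := by
  refine ⟨hγ, fun x => ?_⟩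
  obtain ⟨s, rfl⟩ := exists_seq_eq x
  rw [lieP_eq_lieSeq]
  have h1 := isLieNDerivation_succ_iff.1 hφ s
  have h2 : ⇑φ = ⇑d + ⇑δ + ⇑γ := by rw [hsum]; rfl
  have h3 : δ (lieSeq s (k + 1)) = lieSeqDer δ s (k + 1) := by
    rcases Nat.even_or_odd k with hk | ⟨j, rfl⟩
    · rw [hδ0 hk]
      exact (lieSeqDer_zero s _).symm
    · exact hδ.lieSeq s (j + 1)
  rw [h2, lieSeqDer_add, lieSeqDer_add, lieSeqDer_of_central hγ] at h1
  simp only [Pi.add_apply, hd.lieSeq, h3, add_zero, add_eq_left] at h1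
  exact h1

theorem IsLieNDerivation.exists_decomposition (hφ : IsLieNDerivation (k + 2) φ)
    (h : PeirceSetup e f) (h2 : IsTorsionFreeBy A 2) (hf : φ f ∈ Set.center A)
    (hi :
      CornersCentral e f φ ∨
      (CornerGenerated R e ∧ CornerGenerated R f) ∨
      (CornerGenerated R e ∧ CornerCenterEq R e) ∨
      (CornerGenerated R f ∧ CornerCenterEq R f) ∨
      ((3 ≤ k + 2 → NoCentralInnerDerivation (corner R e) ∨ NoCentralInnerDerivation (corner R f)) ∧
        CornerCenterEq R e ∧ CornerCenterEq R f))
    (hii :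
      (∀ m ∈ peirceComp e f, ∀ t ∈ peirceComp f e,
        e * φ (t * m) * e + f * φ (m * t) * f ∈ Set.center A) ∨
      (NoNonzeroCentralIdeal (corner R e) ∨ NoNonzeroCentralIdeal (corner R f)) ∨
      (∃ m₀ ∈ peirceComp e f, Set.center A =
        {z | ∃ a ∈ cornerOfCenter e, ∃ b ∈ cornerOfCenter f, a * m₀ = m₀ * b ∧ z = a + b}) ∨
      (∃ t₀ ∈ peirceComp f e, Set.center A =
        {z | ∃ a ∈ cornerOfCenter e, ∃ b ∈ cornerOfCenter f, t₀ * a = b * t₀ ∧ z = a + b}) ∨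
      PeirceOrthogonal e f) :
    ∃ d δ γ : A →ₗ[R] A,
      IsDerivationMap d ∧ IsSingularJordanDerivation e f δ ∧ IsCentralVanishing (k + 2) γ ∧
      φ = d + δ + γ ∧
      ((NoNonzeroCentralIdeal (corner R e) ∨ NoNonzeroCentralIdeal (corner R f)) ∨
        PeirceOrthogonal e f → IsAntiderivationMap δ) ∧
      ((Even k ∨ ((∀ m ∈ peirceComp e f, f * φ m * e = 0) ∧
        (∀ t ∈ peirceComp f e, e * φ t * f = 0))) → δ = 0) := by
  have he := hφ.map_mem_center_symm h hf
  have hr := hφ.peirceRel h hf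
  have hr' := hφ.peirceRel h.symm he
  have hc : CornersCentral e f φ := by
    rcases hi with hi | ⟨h3, h4⟩ | ⟨h3, h4⟩ | ⟨h3, h4⟩ | ⟨h3, h4, h5⟩
    · exact hi
    · exact ⟨hr.cornerOfCenter_of_generated hr' h h3,
        hr'.cornerOfCenter_of_generated hr h.symm h4⟩
    · exact hr.cornersCentral_of_generated hr' h h3 h4
    · exact (hr'.cornersCentral_of_generated hr h.symm h3 h4).symm
    · by_cases hk : 3 ≤ k + 2
      · rcases h3 hk with h3 | h3
        · exact hr.cornersCentral_of_noCentralInnerDerivation hr' h h3 h4 h5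
        · exact (hr'.cornersCentral_of_noCentralInnerDerivation hr h.symm h3 h5 h4).symm
      · obtain rfl : k = 0 := by omega
        refine hr.cornersCentral_of_commute hr' h h4 h5 fun b hb a ha => ?_
        have h6 : ⁅a, b⁆ = 0 := by
          rw [Ring.lie_def, mul_eq_zero_of_peirceComp ha hb h.ef,
            mul_eq_zero_of_peirceComp hb ha h.fe, sub_zero]
        have h7 := congrArg (fun x => e * x * e) (hφ.adPow_of_lie_eq_zero h6 f)
        obtain ⟨x, rfl⟩ := ha
        obtain ⟨y, rfl⟩ := hb
        simp only [adPow, Ring.lie_def] at h7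
        simp only [h.rules, sub_self, zero_add, sub_eq_zero] at h7 ⊢
        exact h7.symm
  obtain ⟨d, δ, γ, hsum, H, hδ, hδ', hγ, hδx, ha, hb, hsub⟩ := hr.exists_decomposition hr' h hc
  have hc0 : (0 : A) ∈ cornerOfCenter e ∧ (0 : A) ∈ cornerOfCenter f :=
    ⟨⟨0, Set.zero_mem_center, by simp⟩, ⟨0, Set.zero_mem_center, by simp⟩⟩
  have hd : IsDerivationMap d := by
    rcases hii with hii | (hii | hii) | ⟨m₀, hm₀, hii⟩ | ⟨t₀, ht₀, hii⟩ | hii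
    · exact H.isDerivationMap_of_central hγ ha hb hsub hii
    · exact H.isDerivationMap_of_noNonzeroCentralIdeal hii
    · exact H.symm.isDerivationMap_of_noNonzeroCentralIdeal hii
    · refine H.isDerivationMap_of_right h2 hm₀ fun a haa h0 => ?_
      rw [hii]
      exact ⟨a, haa, 0, hc0.2, by rw [h0, mul_zero], (add_zero a).symm⟩
    · refine H.isDerivationMap_of_left h2 ht₀ fun a haa h0 => ?_
      rw [hii]
      exact ⟨a, haa, 0, hc0.2, by rw [h0, zero_mul], (add_zero a).symm⟩
    · exact H.isDerivationMap_of_orthogonal hii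
  have hδ0 : (Even k ∨ ((∀ m ∈ peirceComp e f, f * φ m * e = 0) ∧
        (∀ t ∈ peirceComp f e, e * φ t * f = 0))) → δ = 0 := by
    intro h0
    ext x
    rw [hδx]
    rcases h0 with h0 | ⟨h0, h1⟩
    · rw [hφ.eq_zero_of_even h h2 hf h0 ⟨x, rfl⟩, hφ.eq_zero_of_even h.symm h2 he h0 ⟨x, rfl⟩]
      simp
    · rw [h0 _ ⟨x, rfl⟩, h1 _ ⟨x, rfl⟩]
      simp
  have hJ := hδ.isSingularJordanDerivation hδ' h
  refine ⟨d, δ, γ, hd, hJ, isCentralVanishing_of_decomposition hφ hsum hd hJ.1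
    (fun hk => hδ0 (.inl hk)) hγ, hsum, ?_, hδ0⟩
  rintro (hn | ho)
  · exact hδ.isAntiderivationMap_of_noNonzeroCentralIdeal hδ' h hn
  · exact hδ.isAntiderivationMap_of_orthogonal hδ' h ho

theorem IsDerivationMap.isLieNDerivation {d : A →ₗ[R] A} (hd : IsDerivationMap d) :
    IsLieNDerivation (k + 1) d :=
  isLieNDerivation_succ_iff.2 fun s => hd.lieSeq s k

theorem IsDerivationMap.add {d d' : A →ₗ[R] A} (hd : IsDerivationMap d)
    (hd' : IsDerivationMap d') : IsDerivationMap (d + d') := by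
  intro x y
  rw [LinearMap.add_apply, hd, hd', LinearMap.add_apply, LinearMap.add_apply]
  noncomm_ring

theorem IsLieNDerivation.sub {φ ψ : A →ₗ[R] A} (hφ : IsLieNDerivation (k + 1) φ)
    (hψ : IsLieNDerivation (k + 1) ψ) : IsLieNDerivation (k + 1) (φ - ψ) := by
  refine isLieNDerivation_succ_iff.2 fun s => ?_
  have h1 := isLieNDerivation_succ_iff.1 hφ s
  have h2 : ⇑φ = ⇑(φ - ψ) + ⇑ψ := by ext x; simp
  rw [h2, lieSeqDer_add, ← isLieNDerivation_succ_iff.1 hψ s] at h1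
  exact add_right_cancel h1

end Main

theorem mainTheorem4 {R A : Type*} [CommRing R] [Ring A] [Algebra R A]
    (e f : A) (he : IsIdempotentElem e) (he0 : e ≠ 0) (he1 : e ≠ 1) (hf : f = 1 - e)
    (hA : PeirceFaithful e f)
    (n : ℕ) (hn : 2 ≤ n) (h2 : IsTorsionFreeBy A 2) (hn1 : IsTorsionFreeBy A (n - 1))
    (φ : A →ₗ[R] A) (hφ : IsLieNDerivation n φ)
    -- one of the conditions (i-1), ..., (i-5)
    (hi :
      CornersCentral e f φ ∨
      (CornerGenerated R e ∧ CornerGenerated R f) ∨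
      (CornerGenerated R e ∧ CornerCenterEq R e) ∨
      (CornerGenerated R f ∧ CornerCenterEq R f) ∨
      ((3 ≤ n → NoCentralInnerDerivation (corner R e) ∨ NoCentralInnerDerivation (corner R f)) ∧
        CornerCenterEq R e ∧ CornerCenterEq R f))
    -- one of the conditions (ii-1), ..., (ii-5)
    (hii :
      (∀ m ∈ peirceComp e f, ∀ t ∈ peirceComp f e,
        e * φ (t * m) * e + f * φ (m * t) * f ∈ Set.center A) ∨
      (NoNonzeroCentralIdeal (corner R e) ∨ NoNonzeroCentralIdeal (corner R f)) ∨
      (∃ m₀ ∈ peirceComp e f, Set.center A =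
        {z | ∃ a ∈ cornerOfCenter e, ∃ b ∈ cornerOfCenter f, a * m₀ = m₀ * b ∧ z = a + b}) ∨
      (∃ t₀ ∈ peirceComp f e, Set.center A =
        {z | ∃ a ∈ cornerOfCenter e, ∃ b ∈ cornerOfCenter f, t₀ * a = b * t₀ ∧ z = a + b}) ∨
      PeirceOrthogonal e f) :
    (∃ d δ γ : A →ₗ[R] A,
      IsDerivationMap d ∧ IsSingularJordanDerivation e f δ ∧ IsCentralVanishing n γ ∧
      φ = d + δ + γ ∧
      -- in the cases (ii-2) and (ii-5)
      ((NoNonzeroCentralIdeal (corner R e) ∨ NoNonzeroCentralIdeal (corner R f)) ∨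
        PeirceOrthogonal e f → IsAntiderivationMap δ)) ∧
    ((Even n ∨
        ((∀ m ∈ peirceComp e f, f * φ m * e = 0) ∧ (∀ t ∈ peirceComp f e, e * φ t * f = 0))) →
      IsStandard n φ) := by
  obtain ⟨k, rfl⟩ : ∃ k, n = k + 2 := ⟨n - 2, by omega⟩
  have h := PeirceSetup.of_isIdempotentElem he hf hA
  set x₀ : A := f * φ f * e - e * φ f * f with hx₀
  set ad : A →ₗ[R] A := LinearMap.mulRight R x₀ - LinearMap.mulLeft R x₀ with had
  have hadx : ∀ x, ad x = x * x₀ - x₀ * x := fun x => rfl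
  have hder : IsDerivationMap ad := by
    intro x y
    rw [hadx, hadx, hadx]
    noncomm_ring
  have hψ : IsLieNDerivation (k + 2) (φ - ad) := hφ.sub hder.isLieNDerivation
  have hψx : ∀ x, (φ - ad) x = φ x - (x * x₀ - x₀ * x) := fun x => rfl
  have hcenter : (φ - ad) f ∈ Set.center A := by
    refine hψ.map_mem_center h hn1 ?_ ?_
    · rw [hψx, hx₀]
      simp only [h.rules]
      abel_nf
    · rw [hψx, hx₀]
      simp only [h.rules]
      abel_nf
  have hee : ∀ b ∈ peirceComp f f, e * (φ - ad) b * e = e * φ b * e := by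
    rintro _ ⟨x, rfl⟩
    rw [hψx, hx₀]
    simp only [h.rules, sub_zero]
  have hff : ∀ a ∈ peirceComp e e, f * (φ - ad) a * f = f * φ a * f := by
    rintro _ ⟨x, rfl⟩
    rw [hψx, hx₀]
    simp only [h.rules, sub_zero]
  have hfe : ∀ m ∈ peirceComp e f, f * (φ - ad) m * e = f * φ m * e := by
    rintro _ ⟨x, rfl⟩
    rw [hψx]
    simp only [h.rules, sub_zero]
  have hef : ∀ m ∈ peirceComp f e, e * (φ - ad) m * f = e * φ m * f := by
    rintro _ ⟨x, rfl⟩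
    rw [hψx]
    simp only [h.rules, sub_zero]
  obtain ⟨d, δ, γ, hd, hδ, hγ, hsum, hanti, hδ0⟩ := hψ.exists_decomposition h h2 hcenter
    (hi.imp_left fun hc => ⟨fun a ha => by rw [hff a ha]; exact hc.1 a ha,
      fun b hb => by rw [hee b hb]; exact hc.2 b hb⟩)
    (hii.imp_left fun hc m hm t ht => by
      rw [hff _ (mul_mem_peirceComp hm ht), hee _ (mul_mem_peirceComp ht hm)]
      exact hc m hm t ht)
  have hsum' : φ = d + ad + δ + γ := by
    rw [← sub_add_cancel φ ad, hsum]
    abel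
  refine ⟨⟨d + ad, δ, γ, hd.add hder, hδ, hγ, hsum', hanti⟩, fun h0 => ⟨d + ad, γ, hd.add hder,
    hγ, ?_⟩⟩
  rw [hδ0, add_zero] at hsum'
  · exact hsum'
  · refine h0.imp (fun h1 => by simpa [parity_simps] using h1) fun h1 => ⟨fun m hm => ?_,
      fun t ht => ?_⟩
    · rw [hfe m hm, h1.1 m hm]
    · rw [hef t ht, h1.2 t ht]
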